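/- Let $\mathbb{G}=(C(\mathbb{G}),\Delta)$ be a compact quantum group: $C(\mathbb{G})\neq 0$ is a unital $C^*$-algebra and $\Delta:C(\mathbb{G})\to C(\mathbb{G})\otimes C(\mathbb{G})$ (minimal tensor product) is a unital $*$-homomorphism with $(\Delta\otimes\mathrm{id})\Delta=(\mathrm{id}\otimes\Delta)\Delta$ such that $\{\Delta(a)(b\otimes 1)\}$ and $\{\Delta(a)(1\otimes b)\}$, $a,b\in C(\mathbb{G})$, span dense subspaces of $C(\mathbb{G})\otimes C(\mathbb{G})$. A finite dimensional representation is an invertible $u=(u_{ij})\in B(H_u)\otimes C(\mathbb{G})\cong M_n(C(\mathbb{G}))$ with $\Delta(u_{ij})=\sum_k u_{ik}\otimes u_{kj}$. Intertwiners are $\mathrm{Hom}(u,w)=\{T\in B(H_u,H_w): w(T\otimes 1)=(T\otimes 1)u\}$, and $u\cong w$ means that $\mathrm{Hom}(u,w)$ contains an invertible operator. A unitary representation $u$ on a nonzero space is irreducible if $\mathrm{Hom}(u,u)=\mathbb{C}\,\mathrm{Id}$. The tensor product $u\otimes w$ has entries $u_{ij}w_{kl}$, and $u\subseteq w$ means $u\oplus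 w'\cong w$ for some representation $w'$. For a unitary representation $u$ put $u^c=(u_{ij}^*)$, and let $Q_u$ be the unique positive invertible matrix such that $(Q_u^{1/2}\otimes 1)u^c(Q_u^{-1/2}\otimes 1)$ is a unitary representation and $\mathrm{Tr}(Q_u\,\cdot)=\mathrm{Tr}(Q_u^{-1}\,\cdot)$ on $\mathrm{Hom}(u^c,u^c)$ (for irreducible $u$: $\mathrm{Tr}\,Q_u=\mathrm{Tr}\,Q_u^{-1}$). Put $d_u=\mathrm{Tr}(Q_u)$ and $\mathrm{Tr}_{Q_u}(X)=\mathrm{Tr}(Q_u^{t}X)$ for $X\in B(H_u)$; here $Q_u$ acts on the conjugate space of $H_u$, and the formula becomes $\mathrm{Tr}(Q_uX)$ when the orthonormal basis of $H_u$ is chosen, as one may, such that $Q_u$ is diagonal. Let $u^\alpha,u^\beta,u^\gamma$ be irreducible unitary representations of $\mathbb{G}$ on $H_\alpha,H_\beta,H_\gamma$, and write $Q_\alpha=Q_{u^\alpha}$, $d_\alpha=d_{u^\alpha}$, etc. Suppose that $u^\alpha\subseteq u^\beta\otimes u^\gamma$. Then there is an isometric intertwiner $v\in\mathrm{Hom}(u^\alpha,u^\beta\otimes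 u^\gamma)$, and for every such $v$ the Clebsch-Gordan map $$\Phi=\Phi^{\alpha\to\beta}_\gamma:B(H_\alpha)\to B(H_\beta),\qquad \Phi(X)=(\mathrm{id}\otimes\mathrm{Tr}_{Q_\gamma})(vXv^*),$$ has the following properties. 1. $\Phi$ is $\mathbb{G}_{(\alpha,\beta)}$-covariant: $(\Phi\otimes\mathrm{id})[u^\alpha(X\otimes 1)(u^\alpha)^*]=u^\beta(\Phi(X)\otimes 1)(u^\beta)^*$ for all $X\in B(H_\alpha)$. 2. $\Phi$ is quantum trace preserving: $\mathrm{Tr}_{Q_\beta}(\Phi(X))=\mathrm{Tr}_{Q_\alpha}(X)$ for all $X\in B(H_\alpha)$. 3. $\Phi(\mathrm{Id}_\alpha)=\frac{d_\alpha}{d_\beta}\mathrm{Id}_\beta$. -/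

import Mathlib

open scoped TensorProduct ENNReal ComplexOrder

universe u

noncomputable section

/-! ## The minimal tensor product of two unital C*-algebras -/

/-- The Hilbert space tensor product of two Hilbert spaces: the completion of the algebraic
tensor product. -/
def HilbertTensor (H K : Type*) [NormedAddCommGroup H] [InnerProductSpace ℂ H]
    [NormedAddCommGroup K] [InnerProductSpace ℂ K] : Type _ :=
  UniformSpace.Completion (H ⊗[ℂ] K)

instance (H K : Type*) [NormedAddCommGroup H] [InnerProductSpace ℂ H]
    [NormedAddCommGroup K] [InnerProductSpace ℂ K] : NormedAddCommGroup (HilbertTensor H K) :=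
  inferInstanceAs (NormedAddCommGroup (UniformSpace.Completion (H ⊗[ℂ] K)))

instance (H K : Type*) [NormedAddCommGroup H] [InnerProductSpace ℂ H]
    [NormedAddCommGroup K] [InnerProductSpace ℂ K] : InnerProductSpace ℂ (HilbertTensor H K) :=
  inferInstanceAs (InnerProductSpace ℂ (UniformSpace.Completion (H ⊗[ℂ] K)))

instance (H K : Type*) [NormedAddCommGroup H] [InnerProductSpace ℂ H]
    [NormedAddCommGroup K] [InnerProductSpace ℂ K] : CompleteSpace (HilbertTensor H K) :=
  inferInstanceAs (CompleteSpace (UniformSpace.Completion (H ⊗[ℂ] K)))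

/-- The elementary tensor of two vectors, in the Hilbert space tensor product. -/
def hilbertTmul {H K : Type*} [NormedAddCommGroup H] [InnerProductSpace ℂ H]
    [NormedAddCommGroup K] [InnerProductSpace ℂ K] (x : H) (y : K) : HilbertTensor H K :=
  ((x ⊗ₜ[ℂ] y : H ⊗[ℂ] K) : UniformSpace.Completion (H ⊗[ℂ] K))

theorem inner_hilbertTmul {H K : Type*} [NormedAddCommGroup H] [InnerProductSpace ℂ H]
    [NormedAddCommGroup K] [InnerProductSpace ℂ K] (x x' : H) (y y' : K) :
    inner ℂ (hilbertTmul x y) (hilbertTmul x' y') = inner ℂ x x' * inner ℂ y y' := by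
  refine (UniformSpace.Completion.inner_coe (𝕜 := ℂ) (x ⊗ₜ[ℂ] y) (x' ⊗ₜ[ℂ] y')).trans ?_
  exact TensorProduct.inner_tmul ℂ x x' y y'

theorem span_hilbertTmul_dense (H K : Type*) [NormedAddCommGroup H] [InnerProductSpace ℂ H]
    [NormedAddCommGroup K] [InnerProductSpace ℂ K] :
    Dense (Submodule.span ℂ {z : HilbertTensor H K | ∃ x y, z = hilbertTmul x y} :
      Set (HilbertTensor H K)) := by
  refine Dense.mono ?_ (UniformSpace.Completion.denseRange_coe (α := H ⊗[ℂ] K))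
  rintro _ ⟨z, rfl⟩
  induction z using TensorProduct.induction_on with
  | zero => exact (Submodule.span ℂ {z : HilbertTensor H K | ∃ x y, z = hilbertTmul x y}).zero_mem
  | tmul x y => exact Submodule.subset_span ⟨x, y, rfl⟩
  | add x y hx hy =>
    rw [UniformSpace.Completion.coe_add]
    exact (Submodule.span ℂ {z : HilbertTensor H K | ∃ x y, z = hilbertTmul x y}).add_mem hx hy

/-- The operator `S ⊗ T` on the Hilbert space tensor product, for bounded operators `S`, `T`. -/
def opTensor {H K : Type*} [NormedAddCommGroup H] [InnerProductSpace ℂ H]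
    [NormedAddCommGroup K] [InnerProductSpace ℂ K] (S : H →L[ℂ] H) (T : K →L[ℂ] K) :
    HilbertTensor H K →L[ℂ] HilbertTensor H K :=
  (TensorProduct.mapL S T).completion

theorem opTensor_hilbertTmul {H K : Type*} [NormedAddCommGroup H] [InnerProductSpace ℂ H]
    [NormedAddCommGroup K] [InnerProductSpace ℂ K] (S : H →L[ℂ] H) (T : K →L[ℂ] K)
    (x : H) (y : K) : opTensor S T (hilbertTmul x y) = hilbertTmul (S x) (T y) :=
  ContinuousLinearMap.completion_apply_coe (TensorProduct.mapL S T) (x ⊗ₜ[ℂ] y)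

theorem norm_opTensor_le {H K : Type*} [NormedAddCommGroup H] [InnerProductSpace ℂ H]
    [NormedAddCommGroup K] [InnerProductSpace ℂ K] (S : H →L[ℂ] H) (T : K →L[ℂ] K) :
    ‖opTensor S T‖ ≤ ‖S‖ * ‖T‖ := by
  refine le_trans ?_ (TensorProduct.norm_mapL_le S T)
  refine ContinuousLinearMap.opNorm_le_bound _
    (norm_nonneg (TensorProduct.mapL S T : H ⊗[ℂ] K →L[ℂ] H ⊗[ℂ] K)) fun z => ?_
  change UniformSpace.Completion (H ⊗[ℂ] K) at z
  change ‖(TensorProduct.mapL S T).completion z‖ ≤ ‖TensorProduct.mapL S T‖ * ‖z‖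
  induction z using UniformSpace.Completion.induction_on with
  | hp => exact isClosed_le (by fun_prop) (by fun_prop)
  | ih z =>
    simp only [ContinuousLinearMap.completion_apply_coe, UniformSpace.Completion.norm_coe]
    exact ContinuousLinearMap.le_opNorm _ _

instance hilbertTensor_nontrivial (H K : Type*) [NormedAddCommGroup H] [InnerProductSpace ℂ H]
    [NormedAddCommGroup K] [InnerProductSpace ℂ K] [Nontrivial H] [Nontrivial K] :
    Nontrivial (HilbertTensor H K) := by
  obtain ⟨x, hx⟩ := exists_ne (0 : H)
  obtain ⟨y, hy⟩ := exists_ne (0 : K)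
  refine ⟨⟨hilbertTmul x y, 0, fun h => ?_⟩⟩
  have h1 := inner_hilbertTmul x x y y
  rw [h, inner_zero_left] at h1
  rcases mul_eq_zero.1 h1.symm with h2 | h2
  · exact hx (inner_self_eq_zero.1 h2)
  · exact hy (inner_self_eq_zero.1 h2)

/-- A unital *-representation of a unital C*-algebra on a nonzero Hilbert space. -/
structure HilbertRep (A : Type u) [CStarAlgebra A] where
  /-- the Hilbert space -/
  space : Type u
  [normedAddCommGroup : NormedAddCommGroup space]
  [innerProductSpace : InnerProductSpace ℂ space]
  [completeSpace : CompleteSpace space]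
  [nontrivial : Nontrivial space]
  /-- the action -/
  hom : A →⋆ₐ[ℂ] (space →L[ℂ] space)

attribute [instance] HilbertRep.normedAddCommGroup HilbertRep.innerProductSpace
  HilbertRep.completeSpace HilbertRep.nontrivial

/-- The C*-algebra `B(H_π ⊗ H_ρ)`, for a pair `(π, ρ)` of representations. -/
def HilbertRep.TensorOps {A B : Type u} [CStarAlgebra A] [CStarAlgebra B]
    (i : HilbertRep A × HilbertRep B) : Type u :=
  HilbertTensor i.1.space i.2.space →L[ℂ] HilbertTensor i.1.space i.2.space

instance {A B : Type u} [CStarAlgebra A] [CStarAlgebra B] (i : HilbertRep A × HilbertRep B) :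
    CStarAlgebra (HilbertRep.TensorOps i) :=
  inferInstanceAs
    (CStarAlgebra (HilbertTensor i.1.space i.2.space →L[ℂ] HilbertTensor i.1.space i.2.space))

instance {A B : Type u} [CStarAlgebra A] [CStarAlgebra B] (i : HilbertRep A × HilbertRep B) :
    Nontrivial (HilbertRep.TensorOps i) :=
  inferInstanceAs
    (Nontrivial (HilbertTensor i.1.space i.2.space →L[ℂ] HilbertTensor i.1.space i.2.space))

/-- The C*-algebra of bounded families of operators on the spaces `H_π ⊗ H_ρ`, where `(π, ρ)`
runs over all pairs of representations of `A` and `B`, with the supremum norm. -/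
def TensorAmbient (A B : Type u) [CStarAlgebra A] [CStarAlgebra B] : Type (u + 1) :=
  lp (fun i : HilbertRep A × HilbertRep B => HilbertRep.TensorOps i) ∞

/-- The pointwise operations and the supremum norm. -/
def tensorAmbientCStarAlgebra (A B : Type u) [CStarAlgebra A] [CStarAlgebra B] :
    CStarAlgebra (TensorAmbient A B) :=
  { (inferInstance : NormedRing (lp (fun i : HilbertRep A × HilbertRep B =>
      HilbertRep.TensorOps i) ∞)),
    (inferInstance : StarRing (lp (fun i : HilbertRep A × HilbertRep B =>
      HilbertRep.TensorOps i) ∞)),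
    (inferInstance : NormedAlgebra ℂ (lp (fun i : HilbertRep A × HilbertRep B =>
      HilbertRep.TensorOps i) ∞)),
    (inferInstance : CStarRing (lp (fun i : HilbertRep A × HilbertRep B =>
      HilbertRep.TensorOps i) ∞)),
    (inferInstance : StarModule ℂ (lp (fun i : HilbertRep A × HilbertRep B =>
      HilbertRep.TensorOps i) ∞)),
    (inferInstance : CompleteSpace (lp (fun i : HilbertRep A × HilbertRep B =>
      HilbertRep.TensorOps i) ∞)) with }

instance (A B : Type u) [CStarAlgebra A] [CStarAlgebra B] : CStarAlgebra (TensorAmbient A B) :=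
  tensorAmbientCStarAlgebra A B

/-- The component at `(π, ρ)` of a bounded family of operators. -/
def ambientEval {A B : Type u} [CStarAlgebra A] [CStarAlgebra B]
    (π : HilbertRep A) (ρ : HilbertRep B) :
    TensorAmbient A B →⋆ₐ[ℂ]
      (HilbertTensor π.space ρ.space →L[ℂ] HilbertTensor π.space ρ.space) where
  toFun t := t.1 (π, ρ)
  map_one' := rfl
  map_mul' _ _ := rfl
  map_zero' := rfl
  map_add' _ _ := rfl
  commutes' _ := rfl
  map_star' _ := rfl

/-- The family `(π(a) ⊗ ρ(b))`, indexed by the pairs `(π, ρ)` of representations. -/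
def ambientTmul {A B : Type u} [CStarAlgebra A] [CStarAlgebra B] (a : A) (b : B) :
    TensorAmbient A B :=
  ⟨fun i => opTensor (i.1.hom a) (i.2.hom b), by
    refine memℓp_infty ⟨‖a‖ * ‖b‖, ?_⟩
    rintro _ ⟨i, rfl⟩
    refine (norm_opTensor_le (i.1.hom a) (i.2.hom b)).trans ?_
    exact mul_le_mul (NonUnitalStarAlgHom.norm_apply_le i.1.hom a)
      (NonUnitalStarAlgHom.norm_apply_le i.2.hom b) (norm_nonneg _) (norm_nonneg _)⟩

/-- The closed *-subalgebra generated by the elementary tensors inside the C*-algebra of bounded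
families of operators. -/
def minTensorSubalgebra (A B : Type u) [CStarAlgebra A] [CStarAlgebra B] :
    StarSubalgebra ℂ (TensorAmbient A B) :=
  (StarAlgebra.adjoin ℂ {t | ∃ (a : A) (b : B), t = ambientTmul a b}).topologicalClosure

instance (A B : Type u) [CStarAlgebra A] [CStarAlgebra B] :
    IsClosed (minTensorSubalgebra A B : Set (TensorAmbient A B)) :=
  StarSubalgebra.isClosed_topologicalClosure _

/-- The minimal (spatial) C*-tensor product `A ⊗ B`: the completion of the algebraic tensor
product in the norm `‖x‖ = sup ‖(π ⊗ ρ)(x)‖`, the supremum over all pairs of representations. -/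
def MinTensor (A B : Type u) [CStarAlgebra A] [CStarAlgebra B] : Type (u + 1) :=
  minTensorSubalgebra A B

/-- The operations and the norm of the closed *-subalgebra. -/
def minTensorCStarAlgebra (A B : Type u) [CStarAlgebra A] [CStarAlgebra B] :
    CStarAlgebra (MinTensor A B) :=
  inferInstanceAs (CStarAlgebra (minTensorSubalgebra A B))

instance (A B : Type u) [CStarAlgebra A] [CStarAlgebra B] : CStarAlgebra (MinTensor A B) :=
  minTensorCStarAlgebra A B

/-- The elementary tensor `a ⊗ b` in the minimal tensor product. -/
def minTmul {A B : Type u} [CStarAlgebra A] [CStarAlgebra B] (a : A) (b : B) : MinTensor A B :=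
  ⟨ambientTmul a b, StarSubalgebra.le_topologicalClosure _
    (StarAlgebra.subset_adjoin ℂ _ ⟨a, b, rfl⟩)⟩

/-- The inclusion of the minimal tensor product into the C*-algebra of bounded families. -/
def minTensorSubtype (A B : Type u) [CStarAlgebra A] [CStarAlgebra B] :
    MinTensor A B →⋆ₐ[ℂ] TensorAmbient A B where
  toFun t := t.1
  map_one' := rfl
  map_mul' _ _ := rfl
  map_zero' := rfl
  map_add' _ _ := rfl
  commutes' _ := rfl
  map_star' _ := rfl

/-- The representation `π ⊗ ρ` of the minimal tensor product `A ⊗ B` on `H_π ⊗ H_ρ`. -/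
def minTensorEval {A B : Type u} [CStarAlgebra A] [CStarAlgebra B]
    (π : HilbertRep A) (ρ : HilbertRep B) :
    MinTensor A B →⋆ₐ[ℂ]
      (HilbertTensor π.space ρ.space →L[ℂ] HilbertTensor π.space ρ.space) :=
  (ambientEval π ρ).comp (minTensorSubtype A B)

theorem minTensorEval_minTmul {A B : Type u} [CStarAlgebra A] [CStarAlgebra B]
    (π : HilbertRep A) (ρ : HilbertRep B) (a : A) (b : B) :
    minTensorEval π ρ (minTmul a b) = opTensor (π.hom a) (ρ.hom b) := rfl

theorem minTensor_ext {A B : Type u} [CStarAlgebra A] [CStarAlgebra B] {s t : MinTensor A B}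
    (h : ∀ (π : HilbertRep A) (ρ : HilbertRep B), minTensorEval π ρ s = minTensorEval π ρ t) :
    s = t :=
  Subtype.ext (Subtype.ext (funext fun i => h i.1 i.2))

/-- For a unital *-homomorphism `Δ : A → A ⊗ A` and representations `π`, `ρ` of `A`, the
representation `(π ⊗ ρ) ∘ Δ` of `A` on `H_π ⊗ H_ρ`. -/
def HilbertRep.conv {A : Type u} [CStarAlgebra A] (Δ : A →⋆ₐ[ℂ] MinTensor A A)
    (π ρ : HilbertRep A) : HilbertRep A where
  space := HilbertTensor π.space ρ.space
  hom := (minTensorEval π ρ).comp Δ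

/-- The vector `x ⊗ y` in the space `H_π ⊗ H_ρ` of the representation `(π ⊗ ρ) ∘ Δ`. -/
def HilbertRep.convTmul {A : Type u} [CStarAlgebra A] (Δ : A →⋆ₐ[ℂ] MinTensor A A)
    {π ρ : HilbertRep A} (x : π.space) (y : ρ.space) : (HilbertRep.conv Δ π ρ).space :=
  hilbertTmul x y

theorem HilbertRep.inner_convTmul {A : Type u} [CStarAlgebra A] (Δ : A →⋆ₐ[ℂ] MinTensor A A)
    {π ρ : HilbertRep A} (x x' : π.space) (y y' : ρ.space) :
    inner ℂ (HilbertRep.convTmul Δ x y) (HilbertRep.convTmul Δ x' y') =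
      inner ℂ x x' * inner ℂ y y' :=
  inner_hilbertTmul x x' y y'

/-! ## Compact quantum groups -/

/-- A compact quantum group with `C(𝔾) = A`: a unital *-homomorphism `Δ : A → A ⊗ A` into the
minimal tensor product which is coassociative and satisfies the density conditions.

Coassociativity `(Δ ⊗ id) Δ = (id ⊗ Δ) Δ` is an identity in the minimal tensor product
`A ⊗ A ⊗ A`. It is expressed in the representations `π ⊗ ρ ⊗ σ` that define the norm of that
algebra, where `(Δ ⊗ id) Δ(a)` acts as `(((π ⊗ ρ) ∘ Δ) ⊗ σ) (Δ(a))` and `(id ⊗ Δ) Δ(a)` as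
`(π ⊗ ((ρ ⊗ σ) ∘ Δ)) (Δ(a))`, by comparing all matrix coefficients at elementary tensors of
vectors; this takes care of the identification of `(H ⊗ K) ⊗ L` with `H ⊗ (K ⊗ L)`. -/
structure CompactQuantumGroup (A : Type u) [CStarAlgebra A] where
  /-- the comultiplication -/
  comul : A →⋆ₐ[ℂ] MinTensor A A
  coassoc : ∀ (π ρ σ : HilbertRep A) (a : A)
    (x x' : π.space) (y y' : ρ.space) (z z' : σ.space),
    inner ℂ (hilbertTmul (HilbertRep.convTmul comul x y) z)
        (minTensorEval (HilbertRep.conv comul π ρ) σ (comul a)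
          (hilbertTmul (HilbertRep.convTmul comul x' y') z')) =
      inner ℂ (hilbertTmul x (HilbertRep.convTmul comul y z))
        (minTensorEval π (HilbertRep.conv comul ρ σ) (comul a)
          (hilbertTmul x' (HilbertRep.convTmul comul y' z')))
  dense_left : Dense (Submodule.span ℂ
    {t : MinTensor A A | ∃ a b : A, t = comul a * minTmul b 1} : Set (MinTensor A A))
  dense_right : Dense (Submodule.span ℂ
    {t : MinTensor A A | ∃ a b : A, t = comul a * minTmul 1 b} : Set (MinTensor A A))

/-! ## Finite dimensional representations

The underlying Hilbert space of a representation with index type `ι` is `ℂ^ι` with its standard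
orthonormal basis, so that `B(H) ⊗ A` is `Matrix ι ι A`. -/

/-- The operator `T ⊗ 1` for a scalar matrix `T`. -/
def scalarAmp (A : Type u) [CStarAlgebra A] {ι κ : Type*} (T : Matrix ι κ ℂ) : Matrix ι κ A :=
  T.map (algebraMap ℂ A)

/-- `u ∈ B(H_u) ⊗ C(𝔾)` is a representation: it is invertible and
`Δ(u_ij) = ∑ₖ u_ik ⊗ u_kj`. -/
structure CompactQuantumGroup.IsRep {A : Type u} [CStarAlgebra A] (G : CompactQuantumGroup A)
    {ι : Type*} [Fintype ι] [DecidableEq ι] (u : Matrix ι ι A) : Prop where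
  isUnit : IsUnit u
  comul_apply : ∀ i j, G.comul (u i j) = ∑ k, minTmul (u i k) (u k j)

/-- A unitary representation. -/
structure CompactQuantumGroup.IsUnitaryRep {A : Type u} [CStarAlgebra A]
    (G : CompactQuantumGroup A) {ι : Type*} [Fintype ι] [DecidableEq ι]
    (u : Matrix ι ι A) : Prop extends G.IsRep u where
  unitary_mem : u ∈ unitary (Matrix ι ι A)

/-- `T ∈ Hom(u, v)`, i.e. `v (T ⊗ 1) = (T ⊗ 1) u`. -/
def IsIntertwiner {A : Type u} [CStarAlgebra A] {ι κ : Type*} [Fintype ι] [Fintype κ]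
    (u : Matrix ι ι A) (v : Matrix κ κ A) (T : Matrix κ ι ℂ) : Prop :=
  v * scalarAmp A T = scalarAmp A T * u

/-- `T` is an isometric intertwiner from `u` to `v`. -/
def IsIsometricIntertwiner {A : Type u} [CStarAlgebra A] {ι κ : Type*} [Fintype ι] [Fintype κ]
    [DecidableEq ι] (u : Matrix ι ι A) (v : Matrix κ κ A) (T : Matrix κ ι ℂ) : Prop :=
  IsIntertwiner u v T ∧ T.conjTranspose * T = 1

/-- `u ≅ v`: there is an invertible intertwiner. -/
def RepEquiv {A : Type u} [CStarAlgebra A] {ι κ : Type*} [Fintype ι] [Fintype κ]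
    [DecidableEq ι] [DecidableEq κ] (u : Matrix ι ι A) (v : Matrix κ κ A) : Prop :=
  ∃ (T : Matrix κ ι ℂ) (S : Matrix ι κ ℂ), S * T = 1 ∧ T * S = 1 ∧ IsIntertwiner u v T

/-- `u` is an irreducible unitary representation (on a nonzero space): `Hom(u, u) = ℂ Id`. -/
structure CompactQuantumGroup.IsIrredUnitaryRep {A : Type u} [CStarAlgebra A]
    (G : CompactQuantumGroup A) {ι : Type*} [Fintype ι] [DecidableEq ι]
    (u : Matrix ι ι A) : Prop extends G.IsUnitaryRep u where
  nonempty : Nonempty ι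
  hom_scalar : ∀ T : Matrix ι ι ℂ, IsIntertwiner u u T → ∃ c : ℂ, T = c • (1 : Matrix ι ι ℂ)

/-- The tensor product `∑ e_ij ⊗ e_kl ⊗ u_ij v_kl`. -/
def repTensor {A : Type u} [CStarAlgebra A] {ι κ : Type*} (u : Matrix ι ι A)
    (v : Matrix κ κ A) : Matrix (ι × κ) (ι × κ) A :=
  Matrix.of fun i j => u i.1 j.1 * v i.2 j.2

/-- `u ⊆ v`: there is a representation `w` with `u ⊕ w ≅ v`. -/
def CompactQuantumGroup.IsSubrep {A : Type u} [CStarAlgebra A] (G : CompactQuantumGroup A)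
    {ι κ : Type*} [Fintype ι] [Fintype κ] [DecidableEq ι] [DecidableEq κ]
    (u : Matrix ι ι A) (v : Matrix κ κ A) : Prop :=
  ∃ (m : ℕ) (w : Matrix (Fin m) (Fin m) A), G.IsRep w ∧ RepEquiv (Matrix.fromBlocks u 0 0 w) v

/-- The contragredient representation `u^c = (u_ij^*)`. -/
def contragredient {A : Type u} [CStarAlgebra A] {ι : Type*} (u : Matrix ι ι A) :
    Matrix ι ι A :=
  u.map star

/-! ## The `Q`-matrix, quantum dimension and quantum trace -/

/-- The defining property of the matrix `Q_u` of a unitary representation `u`: it is positive and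
invertible, `(Q^{1/2} ⊗ 1) u^c (Q^{-1/2} ⊗ 1)` is a unitary representation, and the functionals
`Tr(Q ·)` and `Tr(Q⁻¹ ·)` coincide on `Hom(u^c, u^c)`. Here `R` is the positive square root of
`Q`. For irreducible `u` the last condition is `Tr Q = Tr Q⁻¹`. -/
def CompactQuantumGroup.IsQMatrix {A : Type u} [CStarAlgebra A] (G : CompactQuantumGroup A)
    {ι : Type*} [Fintype ι] [DecidableEq ι] (u : Matrix ι ι A) (Q : Matrix ι ι ℂ) : Prop :=
  Q.PosDef ∧
  (∃ R : Matrix ι ι ℂ, R.PosDef ∧ R * R = Q ∧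
    G.IsUnitaryRep (scalarAmp A R * contragredient u * scalarAmp A R⁻¹)) ∧
  ∀ T : Matrix ι ι ℂ, IsIntertwiner (contragredient u) (contragredient u) T →
    (Q * T).trace = (Q⁻¹ * T).trace

open Classical in
/-- The matrix `Q_u`, an operator on the conjugate space of `H_u`: the unique matrix with the
defining property. (It exists for every unitary representation of a compact quantum group; the
value `1` for other `u` is irrelevant.) -/
def CompactQuantumGroup.qMatrix {A : Type u} [CStarAlgebra A] (G : CompactQuantumGroup A)
    {ι : Type*} [Fintype ι] [DecidableEq ι] (u : Matrix ι ι A) : Matrix ι ι ℂ :=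
  if h : ∃ Q : Matrix ι ι ℂ, G.IsQMatrix u Q then h.choose else 1

/-- The quantum dimension `d_u = Tr(Q_u)`. -/
def CompactQuantumGroup.qDim {A : Type u} [CStarAlgebra A] (G : CompactQuantumGroup A)
    {ι : Type*} [Fintype ι] [DecidableEq ι] (u : Matrix ι ι A) : ℂ :=
  (G.qMatrix u).trace

/-- The quantum trace `Tr_{Q_u}` on `B(H_u)`. Since `Q_u` is an operator on the conjugate of
`H_u`, the operator on `H_u` that corresponds to it is the transpose `Q_uᵗ`, for every choice of
the orthonormal basis of `H_u`; in a basis in which `Q_u` is diagonal this is `Tr(Q_u X)`. -/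
def CompactQuantumGroup.qTrace {A : Type u} [CStarAlgebra A] (G : CompactQuantumGroup A)
    {ι : Type*} [Fintype ι] [DecidableEq ι] (u : Matrix ι ι A) : Matrix ι ι ℂ →ₗ[ℂ] ℂ :=
  Matrix.traceLinearMap ι ℂ ℂ ∘ₗ LinearMap.mulLeft ℂ (G.qMatrix u).transpose

/-- The partial quantum trace `id ⊗ Tr_{Q_w} : B(H ⊗ H_w) → B(H)`. -/
def CompactQuantumGroup.partialQTrace {A : Type u} [CStarAlgebra A] (G : CompactQuantumGroup A)
    (ι : Type*) {κ : Type*} [Fintype κ] [DecidableEq κ] (w : Matrix κ κ A) :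
    Matrix (ι × κ) (ι × κ) ℂ →ₗ[ℂ] Matrix ι ι ℂ where
  toFun Y := Matrix.of fun i j => G.qTrace w (Matrix.of fun k l => Y (i, k) (j, l))
  map_add' Y Z := by
    ext i j
    exact map_add (G.qTrace w) (Matrix.of fun k l => Y (i, k) (j, l))
      (Matrix.of fun k l => Z (i, k) (j, l))
  map_smul' c Y := by
    ext i j
    exact map_smul (G.qTrace w) c (Matrix.of fun k l => Y (i, k) (j, l))

/-! ## Clebsch-Gordan maps and covariance -/

/-- The Clebsch-Gordan map `X ↦ (id ⊗ Tr_{Q_γ})(V X V^*)` from `B(H_α)` to `B(H_β)`, where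
`V : H_α → H_β ⊗ H_γ` is the isometric intertwiner. -/
def CompactQuantumGroup.cgMap {A : Type u} [CStarAlgebra A] (G : CompactQuantumGroup A)
    {α β γ : Type*} [Fintype α] [Fintype β] [Fintype γ] [DecidableEq γ]
    (uγ : Matrix γ γ A) (V : Matrix (β × γ) α ℂ) : Matrix α α ℂ →ₗ[ℂ] Matrix β β ℂ where
  toFun X := G.partialQTrace β uγ (V * X * V.conjTranspose)
  map_add' X Y := by rw [Matrix.mul_add, Matrix.add_mul, map_add]
  map_smul' c X := by
    rw [Matrix.mul_smul, Matrix.smul_mul, map_smul, RingHom.id_apply]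

/-- The amplification `Φ ⊗ id : B(H) ⊗ A → B(K) ⊗ A`, `∑ e_ij ⊗ y_ij ↦ ∑ Φ(e_ij) ⊗ y_ij`. -/
def amplify {A : Type u} [CStarAlgebra A] {ι κ : Type*} [Fintype ι] [DecidableEq ι]
    (Φ : Matrix ι ι ℂ →ₗ[ℂ] Matrix κ κ ℂ) (Y : Matrix ι ι A) : Matrix κ κ A :=
  Matrix.of fun p q => ∑ i, ∑ j, Φ (Matrix.single i j 1) p q • Y i j

/-- `Φ` is `𝔾_(u,v)`-covariant: `(Φ ⊗ id)(u (X ⊗ 1) u^*) = v (Φ(X) ⊗ 1) v^*` for all `X`. -/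
def IsCovariant {A : Type u} [CStarAlgebra A] {ι κ : Type*} [Fintype ι] [Fintype κ]
    [DecidableEq ι] (u : Matrix ι ι A) (v : Matrix κ κ A)
    (Φ : Matrix ι ι ℂ →ₗ[ℂ] Matrix κ κ ℂ) : Prop :=
  ∀ X : Matrix ι ι ℂ, amplify Φ (u * scalarAmp A X * u.conjTranspose) =
    v * scalarAmp A (Φ X) * v.conjTranspose

end

/-! Covariance is formal. In the entries of `(uβ ⊗ uγ)(T ⊗ 1)(uβ ⊗ uγ)^*` the factors from `uγ`
stand next to each other, and contracting them with `Q_γ` returns the scalars `Q_γ`, because `Q_γ`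
is an invariant form for the contragredient of `uγ` (`rightTrace_conj`). The value at the identity
follows from the other two properties: it is an endomorphism of the irreducible `uβ`, hence a
scalar, and the quantum trace determines that scalar.

Trace preservation rests on `kV = Vq` with `k = (Q_β ⊗ Q_γ)ᵗ` and `q = Q_αᵗ`
(`qMatrix_mul_intertwiner`): it turns `Tr(kVXV^*)` into `Tr(VqXV^*) = Tr(qX)`. Invariance of the
forms makes both `kVq⁻¹` and `k⁻¹Vq` intertwiners (`IsInvariantForm.twist`). The functionals `Tr(k
·)` and `Tr(k⁻¹ ·)` agree on the endomorphisms of `uβ ⊗ uγ`, as one sees by replacing one leg at a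
time (`trace_kronecker_eq`), and this forces the two intertwiners to coincide. Hence `k²V = Vq²`,
and positivity removes the squares (`Matrix.PosDef.mul_eq_of_sq`).

The analytic half shows that `Q_u` exists for irreducible `u`, so that `qMatrix` is not its default
value. A Haar state `h` comes from Cesàro means of convolution powers and weak-* compactness
(`ConvolutionData.exists_haar`). Averaging with `h` gives an invariant form `F` for `u^c`. Although
`h` need not be faithful, `F` is definite, by the density condition
(`ConvolutionData.eq_zero_of_isHaar`). The same argument in the opposite quantum group makes `u^c`
invertible on the other side, and a rescaling of `F` balances the two traces. -/

noncomputable section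

/-! ## States of a unital C*-algebra -/

/-- The state space of a unital C*-algebra. -/
def State (A : Type*) [CStarAlgebra A] : Type _ :=
  {f : WeakDual ℂ A // f 1 = 1 ∧ ∀ a, 0 ≤ f (star a * a)}

namespace State

variable {A : Type u} [CStarAlgebra A]

instance : TopologicalSpace (State A) :=
  inferInstanceAs (TopologicalSpace {f : WeakDual ℂ A // f 1 = 1 ∧ ∀ a, 0 ≤ f (star a * a)})

instance : FunLike (State A) A ℂ where
  coe f := f.1
  coe_injective _ _ h := Subtype.ext (DFunLike.coe_injective h)

instance : ContinuousLinearMapClass (State A) ℂ A ℂ where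
  map_add f := map_add f.1
  map_smulₛₗ f := map_smul f.1
  map_continuous f := ContinuousLinearMap.continuous (f.1 : A →L[ℂ] ℂ)

/-- A state as a bounded linear functional. -/
def toCLM (f : State A) : A →L[ℂ] ℂ := f.1

@[simp] theorem toCLM_apply (f : State A) (a : A) : f.toCLM a = f a := rfl

/-- A continuous linear functional which is positive and unital, as a state. -/
def ofCLM (f : A →L[ℂ] ℂ) (h1 : f 1 = 1) (h0 : ∀ a, 0 ≤ f (star a * a)) : State A :=
  ⟨StrongDual.toWeakDual f, h1, h0⟩

@[simp] theorem ofCLM_apply (f : A →L[ℂ] ℂ) (h1 : f 1 = 1) (h0 : ∀ a, 0 ≤ f (star a * a))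
    (a : A) : ofCLM f h1 h0 a = f a := rfl

@[ext] theorem ext {f g : State A} (h : ∀ a, f a = g a) : f = g := DFunLike.ext _ _ h

@[simp] theorem apply_one (f : State A) : f 1 = 1 := f.2.1

theorem nonneg (f : State A) (a : A) : 0 ≤ f (star a * a) := f.2.2 a

theorem continuous_eval (a : A) : Continuous fun f : State A => f a :=
  (WeakDual.eval_continuous a).comp continuous_subtype_val

/-- The vector state given by a unit vector. -/
def ofVector {H : Type*} [NormedAddCommGroup H] [InnerProductSpace ℂ H] [CompleteSpace H]
    (π : A →⋆ₐ[ℂ] (H →L[ℂ] H)) (x : H) (hx : inner ℂ x x = 1) : State A :=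
  ofCLM ((innerSL ℂ x).comp ((ContinuousLinearMap.apply ℂ H x).comp
      (LinearMap.mkContinuous (π : A →ₗ[ℂ] (H →L[ℂ] H)) 1 fun a => by
        simpa using NonUnitalStarAlgHom.norm_apply_le π a)))
    (by simpa using hx) fun a => by
      have : inner ℂ x (π (star a * a) x) = inner ℂ (π a x) (π a x) := by
        rw [map_mul, map_star, mul_apply_eq_comp, ContinuousLinearMap.star_eq_adjoint,
          ContinuousLinearMap.adjoint_inner_right]
      change 0 ≤ inner ℂ x (π (star a * a) x)
      rw [this]
      rw [inner_self_eq_norm_sq_to_K]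
      rw [← RCLike.ofReal_pow]
      exact RCLike.ofReal_nonneg.2 (sq_nonneg ‖π a x‖)

theorem ofVector_apply {H : Type*} [NormedAddCommGroup H] [InnerProductSpace ℂ H] [CompleteSpace H]
    (π : A →⋆ₐ[ℂ] (H →L[ℂ] H)) (x : H) (hx : inner ℂ x x = 1) (a : A) :
    ofVector π x hx a = inner ℂ x (π a x) := rfl

/-- The GNS construction: every state is a vector state. -/
theorem exists_eq_ofVector (f : State A) :
    ∃ (π : HilbertRep A) (x : π.space) (hx : inner ℂ x x = 1), f = ofVector π.hom x hx := by
  let _ := CStarAlgebra.spectralOrder A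
  have := CStarAlgebra.spectralOrderedRing A
  let φ : A →ₚ[ℂ] ℂ := PositiveLinearMap.mk₀ (f.toCLM : A →ₗ[ℂ] ℂ) fun a ha => by
    obtain ⟨b, rfl⟩ := CStarAlgebra.nonneg_iff_eq_star_mul_self.1 ha
    exact f.nonneg b
  let x : φ.GNS := ((φ.toPreGNS 1 : φ.PreGNS) : UniformSpace.Completion φ.PreGNS)
  have key : ∀ a, inner ℂ x (φ.gnsStarAlgHom a x) = f a := fun a => by
    have h1 : φ.gnsStarAlgHom a x = ((φ.toPreGNS a : φ.PreGNS) : φ.GNS) := by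
      simp [x]
    rw [h1, UniformSpace.Completion.inner_coe, PositiveLinearMap.preGNS_inner_def]
    simp [φ]
    rfl
  have hx : inner ℂ x x = 1 := by
    have := key 1
    rwa [map_one, apply_one, one_apply_eq_self] at this
  have : Nontrivial φ.GNS := ⟨⟨x, 0, fun h => by simp [h] at hx⟩⟩
  exact ⟨⟨φ.GNS, φ.gnsStarAlgHom⟩, x, hx, State.ext fun a => (key a).symm⟩

theorem norm_apply_le (f : State A) (a : A) : ‖f a‖ ≤ ‖a‖ := by
  obtain ⟨π, x, hx, rfl⟩ := f.exists_eq_ofVector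
  have hn : ‖x‖ = 1 := by
    rw [inner_self_eq_norm_sq_to_K] at hx
    have h2 : ‖x‖ ^ 2 = 1 := by
      have := congrArg Complex.re hx
      simpa [← Complex.ofReal_pow] using this
    nlinarith [norm_nonneg x]
  rw [ofVector_apply]
  refine (norm_inner_le_norm _ _).trans ?_
  refine (mul_le_mul_of_nonneg_left ((π.hom a).le_opNorm x) (norm_nonneg _)).trans ?_
  simpa [hn] using NonUnitalStarAlgHom.norm_apply_le π.hom a

theorem apply_star (f : State A) (a : A) : f (star a) = star (f a) := by
  obtain ⟨π, x, hx, rfl⟩ := f.exists_eq_ofVector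
  simp only [ofVector_apply, map_star]
  rw [ContinuousLinearMap.star_eq_adjoint, ContinuousLinearMap.adjoint_inner_right]
  exact (inner_conj_symm _ _).symm

/-- The consequence of the Cauchy-Schwarz inequality for the null space of a state. -/
theorem apply_mul_eq_zero (f : State A) {a : A} (ha : f (star a * a) = 0) (b : A) :
    f (b * a) = 0 := by
  obtain ⟨π, x, hx, rfl⟩ := f.exists_eq_ofVector
  simp only [ofVector_apply, map_mul, map_star, mul_apply_eq_comp] at ha ⊢
  rw [ContinuousLinearMap.star_eq_adjoint, ContinuousLinearMap.adjoint_inner_right,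
    inner_self_eq_zero] at ha
  simp [ha]

theorem apply_mul_eq_zero' (f : State A) {a : A} (ha : f (a * star a) = 0) (b : A) :
    f (a * b) = 0 := by
  have := f.apply_mul_eq_zero (a := star a) (by simpa using ha) (star b)
  rw [← star_mul, apply_star] at this
  simpa using this

instance : CompactSpace (State A) := by
  change CompactSpace {f : WeakDual ℂ A // f 1 = 1 ∧ ∀ a, 0 ≤ f (star a * a)}
  rw [← isCompact_univ_iff, Subtype.isCompact_iff, Set.image_univ, Subtype.range_coe_subtype]
  refine (WeakDual.isCompact_closedBall (𝕜 := ℂ) (E := A) 0 1).of_isClosed_subset ?_ ?_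
  · simp only [Set.ofPred_and, Set.ofPred_forall]
    refine (isClosed_singleton.preimage (WeakDual.eval_continuous (1 : A))).inter ?_
    exact isClosed_iInter fun a => isClosed_Ici.preimage (WeakDual.eval_continuous (star a * a))
  · intro f hf
    rw [Set.mem_preimage, mem_closedBall_zero_iff]
    refine ContinuousLinearMap.opNorm_le_bound _ zero_le_one fun a => ?_
    rw [one_mul]
    exact norm_apply_le (⟨f, hf⟩ : State A) a

/-- The average of finitely many states. -/
def average (n : ℕ) (f : Fin (n + 1) → State A) : State A :=
  ofCLM (((n : ℂ) + 1)⁻¹ • ∑ k, (f k).toCLM)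
    (by
      have : ((n : ℂ) + 1) ≠ 0 := by exact_mod_cast n.succ_ne_zero
      simp [sum_apply, this])
    fun a => by
      have : (0 : ℂ) ≤ ((n : ℂ) + 1)⁻¹ := by
        have : (0 : ℝ) ≤ ((n : ℝ) + 1)⁻¹ := by positivity
        rw [← Complex.zero_le_real] at this
        simpa using this
      simp only [smul_apply, sum_apply, toCLM_apply,
        smul_eq_mul]
      exact mul_nonneg this (Finset.sum_nonneg fun k _ => (f k).nonneg a)

theorem average_apply (n : ℕ) (f : Fin (n + 1) → State A) (a : A) :
    average n f a = ((n : ℂ) + 1)⁻¹ * ∑ k, f k a := by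
  simp [average, sum_apply]

/-- A contractive unital functional is a state. -/
def ofContractive (f : A →L[ℂ] ℂ) (h1 : f 1 = 1) (hf : ‖f‖ ≤ 1) : State A :=
  ofCLM f h1 fun a => by
    let _ := CStarAlgebra.spectralOrder A
    have := CStarAlgebra.spectralOrderedRing A
    have hle : ∀ x, ‖f x‖ ≤ ‖x‖ := fun x =>
      (f.le_opNorm x).trans (mul_le_of_le_one_left (norm_nonneg x) hf)
    have hx0 : 0 ≤ star a * a := star_mul_self_nonneg a
    generalize hxe : star a * a = x at hx0
    have hsa : star x = x := (IsSelfAdjoint.of_nonneg hx0).star_eq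
    have him : (f x).im = 0 := by
      have key : ∀ t : ℝ, (f x).re ^ 2 + ((f x).im + t) ^ 2 ≤ ‖x‖ ^ 2 + t ^ 2 := fun t => by
        have h2 := hle (x + ((t : ℂ) * Complex.I) • (1 : A))
        rw [map_add, map_smul, h1, smul_eq_mul, mul_one] at h2
        have h3 : ‖x + ((t : ℂ) * Complex.I) • (1 : A)‖ ^ 2 ≤ ‖x‖ ^ 2 + t ^ 2 := by
          rw [sq, ← CStarRing.norm_star_mul_self]
          have : star (x + ((t : ℂ) * Complex.I) • (1 : A)) * (x + ((t : ℂ) * Complex.I) • (1 : A))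
              = x * x + ((t : ℂ) ^ 2) • (1 : A) := by
            simp only [star_add, star_smul, star_one, hsa, Complex.star_def, map_mul,
              Complex.conj_ofReal, Complex.conj_I]
            simp only [add_mul, mul_add, smul_mul_assoc, mul_smul_comm, one_mul, mul_one, smul_add,
              smul_smul]
            rw [show ((t : ℂ) * Complex.I) * (t * -Complex.I) = (t : ℂ) ^ 2 by
              linear_combination (-(t : ℂ) ^ 2) * Complex.I_sq, mul_neg, neg_smul]
            abel
          rw [this]
          refine (norm_add_le _ _).trans ?_
          refine add_le_add ((norm_mul_le _ _).trans_eq (sq _).symm) ?_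
          rw [norm_smul]
          refine (mul_le_of_le_one_right (norm_nonneg _) ?_).trans ?_
          · nlinarith [CStarRing.norm_star_mul_self (x := (1 : A)), norm_nonneg (1 : A),
              (by simp : ‖star (1 : A) * 1‖ = ‖(1 : A)‖)]
          · simp
        have h4 := (pow_le_pow_left₀ (norm_nonneg _) h2 2).trans h3
        rw [Complex.sq_norm, Complex.normSq_apply] at h4
        simp at h4
        nlinarith
      by_contra hne
      -- In `key` the terms `t²` cancel, leaving `re² + im² + 2 t im ≤ ‖x‖²`. This `t` makes the
      -- cross term `2‖x‖²`, which is impossible if `im ≠ 0`.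
      have h5 := key (‖x‖ ^ 2 / (f x).im)
      have h6 : (f x).im * (‖x‖ ^ 2 / (f x).im) = ‖x‖ ^ 2 := by field_simp
      have h7 : 0 < (f x).im ^ 2 := by positivity
      nlinarith [sq_nonneg (f x).re, sq_nonneg ‖x‖]
    have hre : 0 ≤ (f x).re := by
      rcases (norm_nonneg x).eq_or_lt with h0 | hpos
      · rw [norm_eq_zero.1 h0.symm]; simp
      · set c := ‖x‖ with hc
        -- From `0 ≤ x ≤ c` one gets `‖c - x‖ ≤ c`; contractivity then bounds the real part of `c -
        -- f x` by `c`.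
        have hxc : x ≤ algebraMap ℝ A c := IsSelfAdjoint.le_algebraMap_norm_self (.of_nonneg hx0)
        have h2 : ‖algebraMap ℝ A c - x‖ ≤ c :=
          (CStarAlgebra.mem_Icc_algebraMap_iff_norm_le hpos.le).1
            ⟨sub_nonneg.2 hxc, sub_le_self _ hx0⟩ |>.2
        have h3 := (hle _).trans h2
        rw [map_sub, Algebra.algebraMap_eq_smul_one, ← Complex.coe_smul, map_smul, h1] at h3
        have h4 := (Complex.re_le_norm _).trans h3
        simp at h4
        exact h4
    exact Complex.nonneg_iff.2 ⟨hre, him.symm⟩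

/-- On the commutative C*-algebra generated by `a` some character attains the spectral radius, which
is the norm of `a`. A norm-preserving Hahn-Banach extension of it is contractive and unital, hence a
state. -/
theorem exists_norm_apply_eq [Nontrivial A] {a : A} (ha : IsSelfAdjoint a) :
    ∃ f : State A, ‖f a‖ = ‖a‖ := by
  have : IsStarNormal a := ha.isStarNormal
  let C := StarAlgebra.elemental ℂ a
  let b : C := ⟨a, StarAlgebra.elemental.self_mem ℂ a⟩
  have hb : IsSelfAdjoint b := Subtype.ext ha
  obtain ⟨z, hz, hzn⟩ := spectrum.exists_nnnorm_eq_spectralRadius b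
  rw [hb.spectralRadius_eq_nnnorm] at hzn
  obtain ⟨χ, hχ⟩ := WeakDual.CharacterSpace.mem_spectrum_iff_exists.1 hz
  obtain ⟨g, hg, hgn⟩ := exists_extension_norm_eq (𝕜 := ℂ) (E := A)
    (Subalgebra.toSubmodule C.toSubalgebra) (WeakDual.toStrongDual (χ : WeakDual ℂ C))
  have hg1 : g 1 = 1 := (hg (1 : C)).trans (map_one χ)
  have hgle : ‖g‖ ≤ 1 := by
    rw [hgn]
    exact (WeakDual.CharacterSpace.norm_le_norm_one χ).trans_eq norm_one
  refine ⟨ofContractive g hg1 hgle, ?_⟩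
  have h1 : g a = z := (hg b).trans hχ
  change ‖g a‖ = ‖a‖
  rw [h1]
  exact congrArg NNReal.toReal (ENNReal.coe_injective hzn)

instance [Nontrivial A] : Nonempty (State A) :=
  ⟨(exists_norm_apply_eq (IsSelfAdjoint.zero A)).choose⟩

/-- States recover the norm of self-adjoint elements only, so `a` is split into real and imaginary
part; this costs the factor 2. -/
theorem norm_le_of_forall [Nontrivial A] {a : A} {r : ℝ} (h : ∀ f : State A, ‖f a‖ ≤ r) :
    ‖a‖ ≤ 2 * r := by
  have hadj : ∀ f : State A, ‖f (star a)‖ ≤ r := fun f => by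
    rw [apply_star, norm_star]; exact h f
  have hre : ‖(realPart a : A)‖ ≤ r := by
    obtain ⟨f, hf⟩ := exists_norm_apply_eq (realPart a).2
    rw [← hf, realPart_apply_coe, ← Complex.coe_smul, map_smul, map_add, norm_smul]
    have := norm_add_le (f a) (f (star a))
    have h2 := hadj f
    have h1 := h f
    simp
    linarith
  have him : ‖(imaginaryPart a : A)‖ ≤ r := by
    obtain ⟨f, hf⟩ := exists_norm_apply_eq (imaginaryPart a).2
    rw [← hf, imaginaryPart_apply_coe, ← Complex.coe_smul, map_smul, map_smul, map_sub, norm_smul,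
      norm_smul]
    have := norm_sub_le (f a) (f (star a))
    have h2 := hadj f
    have h1 := h f
    simp
    linarith
  calc ‖a‖ = ‖(realPart a : A) + Complex.I • (imaginaryPart a : A)‖ := by
        rw [realPart_add_I_smul_imaginaryPart]
    _ ≤ r + r := by
        refine (norm_add_le _ _).trans (add_le_add hre ?_)
        rw [norm_smul, Complex.norm_I, one_mul]; exact him
    _ = 2 * r := by ring

theorem eq_of_forall [Nontrivial A] {a b : A} (h : ∀ f : State A, f a = f b) : a = b := by
  have : ‖a - b‖ ≤ 2 * 0 := norm_le_of_forall fun f => by simp [h f]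
  simpa [sub_eq_zero] using this

end State

/-- The pullback of a state along a unital *-homomorphism. -/
def State.comap {A B : Type*} [CStarAlgebra A] [CStarAlgebra B] (φ : A →⋆ₐ[ℂ] B) (f : State B) :
    State A :=
  State.ofCLM (f.toCLM.comp (LinearMap.mkContinuous (φ : A →ₗ[ℂ] B) 1 fun a => by
      simpa using NonUnitalStarAlgHom.norm_apply_le φ a))
    (by simp) fun a => by
      change 0 ≤ f (φ (star a * a))
      rw [map_mul, map_star]
      exact f.nonneg (φ a)

/-! ### Convolution of states and slice maps -/

/-- An abstract form of a comultiplication `A → B = A ⊗ A`, which remembers the two embeddings of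
`A` in `B`, the product states on `B`, and the density conditions of a compact quantum group. Unlike
the notion of a compact quantum group it is visibly symmetric in the two legs. -/
structure ConvolutionData (A B : Type*) [CStarAlgebra A] [CStarAlgebra B] where
  /-- the embedding `a ↦ a ⊗ 1` -/
  inl : A →⋆ₐ[ℂ] B
  /-- the embedding `a ↦ 1 ⊗ a` -/
  inr : A →⋆ₐ[ℂ] B
  comm : ∀ a b, inl a * inr b = inr b * inl a
  dense : Dense (Submodule.span ℂ {t | ∃ a b, t = inl a * inr b} : Set B)
  /-- the product of two states -/
  prod : State A → State A → State B
  prod_apply : ∀ ω ρ a b, prod ω ρ (inl a * inr b) = ω a * ρ b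
  /-- the comultiplication -/
  comul : A →⋆ₐ[ℂ] B
  dense_left : Dense (Submodule.span ℂ {t | ∃ a b, t = comul a * inl b} : Set B)
  dense_right : Dense (Submodule.span ℂ {t | ∃ a b, t = comul a * inr b} : Set B)
  coassoc : ∀ ω ρ σ a, prod ((prod ω ρ).comap comul) σ (comul a) =
    prod ω ((prod ρ σ).comap comul) (comul a)

theorem ContinuousLinearMap.eq_of_dense_span {E F : Type*} [NormedAddCommGroup E] [NormedSpace ℂ E]
    [NormedAddCommGroup F] [NormedSpace ℂ F] {s : Set E} (hs : Dense (Submodule.span ℂ s : Set E))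
    {f g : E →L[ℂ] F} (h : ∀ x ∈ s, f x = g x) : f = g :=
  ContinuousLinearMap.ext_on hs h

namespace ConvolutionData

variable {A B : Type*} [CStarAlgebra A] [CStarAlgebra B] (L : ConvolutionData A B)

/-- The exchange of the two legs. -/
def op : ConvolutionData A B where
  inl := L.inr
  inr := L.inl
  comm a b := (L.comm b a).symm
  dense := by
    convert L.dense using 5 with t
    constructor <;> rintro ⟨a, b, rfl⟩ <;> exact ⟨b, a, by rw [L.comm]⟩
  prod ω ρ := L.prod ρ ω
  prod_apply ω ρ a b := by rw [← L.comm, L.prod_apply, mul_comm]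
  comul := L.comul
  dense_left := L.dense_right
  dense_right := L.dense_left
  coassoc ω ρ σ a := (L.coassoc σ ρ ω a).symm

/-- The convolution product of two states. -/
def conv (ω ρ : State A) : State A := (L.prod ω ρ).comap L.comul

theorem conv_apply (ω ρ : State A) (a : A) : L.conv ω ρ a = L.prod ω ρ (L.comul a) := rfl

theorem conv_assoc (ω ρ σ : State A) : L.conv (L.conv ω ρ) σ = L.conv ω (L.conv ρ σ) :=
  State.ext fun a => L.coassoc ω ρ σ a

theorem prod_inl (ω ρ : State A) (a : A) : L.prod ω ρ (L.inl a) = ω a := by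
  simpa using L.prod_apply ω ρ a 1

theorem prod_inr (ω ρ : State A) (a : A) : L.prod ω ρ (L.inr a) = ρ a := by
  simpa using L.prod_apply ω ρ 1 a

theorem prod_eq_sum {ι : Type*} (s : Finset ι) (c : ι → ℂ) (f : ι → State A) (g ρ : State A)
    (h : ∀ a, g a = ∑ k ∈ s, c k * f k a) (t : B) :
    L.prod g ρ t = ∑ k ∈ s, c k * L.prod (f k) ρ t := by
  have : (L.prod g ρ).toCLM = ∑ k ∈ s, c k • (L.prod (f k) ρ).toCLM := by
    refine ContinuousLinearMap.eq_of_dense_span L.dense ?_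
    rintro _ ⟨a, b, rfl⟩
    simp [L.prod_apply, h, Finset.sum_mul, mul_assoc]
  simpa using DFunLike.congr_fun this t

/-- For elementary tensors this is continuity of evaluation in each factor. Since all product states
are contractive, approximating `t` in norm by sums of elementary tensors is uniform in the pair of
states. -/
theorem continuous_prod (t : B) :
    Continuous fun p : State A × State A => L.prod p.1 p.2 t := by
  have hspan : ∀ t ∈ Submodule.span ℂ {t | ∃ a b, t = L.inl a * L.inr b},
      Continuous fun p : State A × State A => L.prod p.1 p.2 t := by
    intro t ht
    induction ht using Submodule.span_induction with
    | mem t ht =>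
      obtain ⟨a, b, rfl⟩ := ht
      simp only [L.prod_apply]
      exact ((State.continuous_eval a).comp continuous_fst).mul
        ((State.continuous_eval b).comp continuous_snd)
    | zero => simpa using continuous_const
    | add x y _ _ hx hy => simp only [map_add]; exact hx.add hy
    | smul c x _ hx => simp only [map_smul]; exact hx.const_smul c
  refine continuous_of_uniform_approx_of_continuous fun v hv => ?_
  obtain ⟨ε, hε, hv⟩ := Metric.mem_uniformity_dist.1 hv
  obtain ⟨s, hs, hst⟩ := L.dense.exists_dist_lt t hε
  refine ⟨_, hspan s hs, fun p => hv ?_⟩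
  rw [dist_eq_norm, ← map_sub]
  refine ((L.prod p.1 p.2).norm_apply_le _).trans_lt ?_
  rwa [← dist_eq_norm]

theorem continuous_conv_left (ρ : State A) (a : A) : Continuous fun ω => L.conv ω ρ a :=
  (L.continuous_prod (L.comul a)).comp (continuous_id.prodMk continuous_const)

section Slice

variable [Nontrivial A]

theorem exists_slice (ρ : State A) (t : B) : ∃ s : A, ∀ ω : State A, ω s = L.prod ω ρ t := by
  let M : Submodule ℂ B :=
    { carrier := {t | ∃ s : A, ∀ ω : State A, ω s = L.prod ω ρ t}
      zero_mem' := ⟨0, fun ω => by simp⟩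
      add_mem' := by
        rintro x y ⟨s, hs⟩ ⟨r, hr⟩
        exact ⟨s + r, fun ω => by simp [hs, hr]⟩
      smul_mem' := by
        rintro c x ⟨s, hs⟩
        exact ⟨c • s, fun ω => by simp [hs]⟩ }
  have hM : IsClosed (M : Set B) := by
    refine isClosed_of_closure_subset fun t ht => ?_
    obtain ⟨x, hx, hxt⟩ := mem_closure_iff_seq_limit.1 ht
    choose s hs using hx
    have hdist : ∀ m n, dist (s m) (s n) ≤ 2 * dist (x m) (x n) := fun m n => by
      rw [dist_eq_norm, dist_eq_norm]
      refine State.norm_le_of_forall fun ω => ?_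
      rw [map_sub, hs, hs, ← map_sub]
      exact State.norm_apply_le _ _
    have hc : CauchySeq s := by
      have hx := hxt.cauchySeq
      rw [Metric.cauchySeq_iff] at hx ⊢
      intro ε hε
      obtain ⟨N, hN⟩ := hx (ε / 2) (by positivity)
      refine ⟨N, fun m hm n hn => (hdist m n).trans_lt ?_⟩
      linarith [hN m hm n hn]
    obtain ⟨r, hr⟩ := cauchySeq_tendsto_of_complete hc
    refine ⟨r, fun ω => tendsto_nhds_unique (((map_continuous ω).tendsto r).comp hr) ?_⟩
    refine (((map_continuous (L.prod ω ρ)).tendsto t).comp hxt).congr fun n => ?_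
    exact (hs n ω).symm
  have hle : Submodule.span ℂ {t | ∃ a b, t = L.inl a * L.inr b} ≤ M := by
    refine Submodule.span_le.2 ?_
    rintro _ ⟨a, b, rfl⟩
    exact ⟨ρ b • a, fun ω => by rw [L.prod_apply, map_smul, smul_eq_mul, mul_comm]⟩
  exact hM.closure_subset (closure_mono hle (L.dense t))

/-- The slice map `id ⊗ ρ : B → A`. -/
def slice (ρ : State A) : B →L[ℂ] A :=
  LinearMap.mkContinuous
    { toFun := fun t => (L.exists_slice ρ t).choose
      map_add' := fun x y => State.eq_of_forall fun ω => by
        rw [(L.exists_slice ρ (x + y)).choose_spec, map_add, map_add,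
          (L.exists_slice ρ x).choose_spec, (L.exists_slice ρ y).choose_spec]
      map_smul' := fun c x => State.eq_of_forall fun ω => by
        rw [(L.exists_slice ρ (c • x)).choose_spec, map_smul, map_smul,
          (L.exists_slice ρ x).choose_spec, RingHom.id_apply] }
    2 fun t => State.norm_le_of_forall fun ω => by
      change ‖ω (L.exists_slice ρ t).choose‖ ≤ ‖t‖
      rw [(L.exists_slice ρ t).choose_spec]
      exact State.norm_apply_le _ _

theorem apply_slice (ω ρ : State A) (t : B) : ω (L.slice ρ t) = L.prod ω ρ t :=
  (L.exists_slice ρ t).choose_spec ω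

theorem slice_tmul (ρ : State A) (a b : A) : L.slice ρ (L.inl a * L.inr b) = ρ b • a :=
  State.eq_of_forall fun ω => by rw [apply_slice, L.prod_apply, map_smul, smul_eq_mul, mul_comm]

theorem slice_mul_inl (ρ : State A) (t : B) (c : A) :
    L.slice ρ (t * L.inl c) = L.slice ρ t * c := by
  have : (L.slice ρ).comp ((ContinuousLinearMap.mul ℂ B).flip (L.inl c)) =
      ((ContinuousLinearMap.mul ℂ A).flip c).comp (L.slice ρ) := by
    refine ContinuousLinearMap.eq_of_dense_span L.dense ?_
    rintro _ ⟨a, b, rfl⟩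
    have : L.inl a * L.inr b * L.inl c = L.inl (a * c) * L.inr b := by
      rw [mul_assoc, ← L.comm, ← mul_assoc, map_mul]
    change L.slice ρ (L.inl a * L.inr b * L.inl c) = L.slice ρ (L.inl a * L.inr b) * c
    rw [this, slice_tmul, slice_tmul, smul_mul_assoc]
  exact DFunLike.congr_fun this t

theorem slice_star (ρ : State A) (t : B) : L.slice ρ (star t) = star (L.slice ρ t) :=
  State.eq_of_forall fun ω => by
    rw [apply_slice, State.apply_star, State.apply_star, apply_slice]

theorem slice_inl_mul (ρ : State A) (t : B) (c : A) :
    L.slice ρ (L.inl c * t) = c * L.slice ρ t := by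
  have := L.slice_mul_inl ρ (star t) (star c)
  rw [slice_star, map_star, ← star_mul, slice_star, ← star_mul] at this
  exact star_injective this

theorem prod_mul_inl (ω ρ : State A) (t : B) (c : A) :
    L.prod ω ρ (t * L.inl c) = ω (L.slice ρ t * c) := by
  rw [← slice_mul_inl, apply_slice]

theorem prod_inl_mul (ω ρ : State A) (t : B) (c : A) :
    L.prod ω ρ (L.inl c * t) = ω (c * L.slice ρ t) := by
  rw [← slice_inl_mul, apply_slice]

/-- Coassociativity for slices: testing with an arbitrary state reduces it to associativity of
convolution. -/
theorem slice_comul_slice_comul (ρ σ : State A) (a : A) :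
    L.slice ρ (L.comul (L.slice σ (L.comul a))) = L.slice (L.conv ρ σ) (L.comul a) :=
  State.eq_of_forall fun ω => by
    rw [apply_slice, apply_slice, ← conv_apply, ← conv_apply, ← conv_assoc, apply_slice, conv_apply]

/-- If `h` is invariant under the convolution with the average of `ω₀` and `ω₁`, then it is
invariant under the convolution with `ω₀` and `ω₁`. -/
theorem conv_eq_of_average {n : ℕ} (f : Fin (n + 1) → State A) (h : State A)
    (hl : L.conv (State.average n f) h = h) (hr : L.conv h (State.average n f) = h)
    (k : Fin (n + 1)) : L.conv (f k) h = h := by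
  set ω := State.average n f with hω
  -- With `b = (id ⊗ h)Δ(a)` one has `(id ⊗ ω)Δ(b) = b`. Expanding `t = Δ(b) - b ⊗ 1`, each of the
  -- four terms of `(h ⊗ ω)(t^*t)` is `±h(b^*b)`, with total 0. As `h ⊗ ω` is an average of the
  -- positive `h ⊗ f k`, each of these kills `t^*t` as well.
  have hzero : ∀ a, ∀ t, t = L.comul (L.slice h (L.comul a)) - L.inl (L.slice h (L.comul a)) →
      L.prod h (f k) (star t * t) = 0 := by
    intro a t ht
    set b := L.slice h (L.comul a) with hb
    have hsb : L.slice ω (L.comul b) = b := by rw [hb, slice_comul_slice_comul, hl]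
    have h0 : L.prod h ω (star t * t) = 0 := by
      have e1 : L.prod h ω (L.comul (star b * b)) = h (star b * b) := by
        rw [← conv_apply, hr]
      have e2 : L.prod h ω (L.comul (star b) * L.inl b) = h (star b * b) := by
        rw [prod_mul_inl, map_star, slice_star, hsb]
      have e3 : L.prod h ω (L.inl (star b) * L.comul b) = h (star b * b) := by
        rw [prod_inl_mul, hsb]
      have e4 : L.prod h ω (L.inl (star b * b)) = h (star b * b) := L.prod_inl _ _ _
      have : star t * t = L.comul (star b * b) - L.comul (star b) * L.inl b -
          L.inl (star b) * L.comul b + L.inl (star b * b) := by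
        rw [ht, star_sub, map_mul, map_mul, map_star, map_star]
        noncomm_ring
      rw [this, map_add, map_sub, map_sub, e1, e2, e3, e4]
      ring
    have hsum := L.op.prod_eq_sum Finset.univ (fun _ => ((n : ℂ) + 1)⁻¹) f ω h
      (fun a => by rw [hω, State.average_apply, Finset.mul_sum]) (star t * t)
    change L.prod h ω (star t * t) = ∑ k, ((n : ℂ) + 1)⁻¹ * L.prod h (f k) (star t * t) at hsum
    rw [h0, ← Finset.mul_sum] at hsum
    have hn : ((n : ℂ) + 1)⁻¹ ≠ 0 := inv_ne_zero (by exact_mod_cast n.succ_ne_zero)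
    have := (mul_eq_zero.1 hsum.symm).resolve_left hn
    exact (Finset.sum_eq_zero_iff_of_nonneg fun k _ => (L.prod h (f k)).nonneg t).1 this k
      (Finset.mem_univ k)
  -- By Cauchy-Schwarz `h ⊗ f k` kills `(c ⊗ 1)t`. Absorbing the slice by `h` into the second state
  -- turns this into an identity on the elements `(c ⊗ 1)Δ(a)`.
  have key : ∀ a c, L.prod h (L.conv (f k) h) (L.inl c * L.comul a) =
      L.prod h h (L.inl c * L.comul a) := by
    intro a c
    have h1 := (L.prod h (f k)).apply_mul_eq_zero (hzero a _ rfl) (L.inl c)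
    rw [mul_sub, map_sub, sub_eq_zero, prod_inl_mul, slice_comul_slice_comul, ← map_mul,
      prod_inl] at h1
    rw [prod_inl_mul, prod_inl_mul, h1]
  -- The adjoints `Δ(a)(c ⊗ 1)` span a dense subspace, so the product states agree; restricting them
  -- to `1 ⊗ A` leaves the second factors.
  have key' : L.prod h (L.conv (f k) h) = L.prod h h := by
    have : (L.prod h (L.conv (f k) h)).toCLM = (L.prod h h).toCLM := by
      refine ContinuousLinearMap.eq_of_dense_span L.dense_left ?_
      rintro _ ⟨a, c, rfl⟩
      have := key (star a) (star c)
      rw [map_star, map_star, ← star_mul, State.apply_star, State.apply_star] at this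
      exact star_injective this
    exact State.ext fun t => DFunLike.congr_fun this t
  exact State.ext fun a => by rw [← L.prod_inr h (L.conv (f k) h), key', prod_inr]

end Slice

/-! ### Existence of the Haar state -/

/-- The convolution powers `ω, ω * ω, …` of a state. -/
def convPow (ω : State A) : ℕ → State A
  | 0 => ω
  | n + 1 => L.conv ω (convPow ω n)

theorem convPow_conv (ω : State A) (n : ℕ) :
    L.conv (L.convPow ω n) ω = L.convPow ω (n + 1) := by
  induction n with
  | zero => rfl
  | succ n ih => rw [convPow, conv_assoc, ih]; rfl

/-- The set of states which are invariant under the convolution with `ω` on both sides. -/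
def invariantStates (ω : State A) : Set (State A) := {h | L.conv ω h = h ∧ L.conv h ω = h}

theorem isClosed_invariantStates (ω : State A) : IsClosed (L.invariantStates ω) := by
  have : L.invariantStates ω =
      ⋂ a, ({h | L.op.conv h ω a = h a} ∩ {h | L.conv h ω a = h a}) := by
    ext h
    simp only [invariantStates, Set.mem_ofPred_eq, Set.mem_iInter, Set.mem_inter_iff]
    exact ⟨fun hh a => ⟨DFunLike.congr_fun hh.1 a, DFunLike.congr_fun hh.2 a⟩,
      fun hh => ⟨State.ext fun a => (hh a).1, State.ext fun a => (hh a).2⟩⟩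
  rw [this]
  exact isClosed_iInter fun a =>
    (isClosed_eq (L.op.continuous_conv_left ω a) (State.continuous_eval a)).inter
      (isClosed_eq (L.continuous_conv_left ω a) (State.continuous_eval a))

theorem nonempty_invariantStates (ω : State A) : (L.invariantStates ω).Nonempty := by
  let h : ℕ → State A := fun n => State.average n fun k => L.convPow ω k
  -- The state space is compact but possibly not metrizable, so the Cesàro means are followed along
  -- a nonprincipal ultrafilter instead of a subsequence.
  obtain ⟨g, hg⟩ : ∃ g, Filter.Tendsto h (Filter.hyperfilter ℕ : Filter ℕ) (nhds g) := by
    obtain ⟨g, -, hg⟩ := isCompact_univ.ultrafilter_le_nhds ((Filter.hyperfilter ℕ).map h)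
      (by simp)
    exact ⟨g, hg⟩
  have hat : ((Filter.hyperfilter ℕ : Ultrafilter ℕ) : Filter ℕ) ≤ Filter.atTop := by
    rw [← Nat.cofinite_eq_atTop]; exact Filter.hyperfilter_le_cofinite
  have key : ∀ c : State A → State A, (∀ a, Continuous fun σ => c σ a) →
      (∀ n a, c (h n) a = ((n : ℂ) + 1)⁻¹ * ∑ k : Fin (n + 1), L.convPow ω (k + 1) a) →
      c g = g := by
    intro c hc hcn
    refine State.ext fun a => ?_
    have h1 : Filter.Tendsto (fun n => c (h n) a) (Filter.hyperfilter ℕ : Filter ℕ)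
        (nhds (c g a)) := ((hc a).tendsto g).comp hg
    have h2 : Filter.Tendsto (fun n => h n a) (Filter.hyperfilter ℕ : Filter ℕ) (nhds (g a)) :=
      ((State.continuous_eval a).tendsto g).comp hg
    -- The sum telescopes to `(convPow (n+1) - convPow 0)/(n+1)`, of norm at most `2‖a‖/(n+1)`.
    have h3 : Filter.Tendsto (fun n => c (h n) a - h n a) Filter.atTop (nhds 0) := by
      refine squeeze_zero_norm (a := fun n : ℕ => 2 * ‖a‖ * (1 / ((n : ℝ) + 1))) (fun n => ?_) ?_
      · rw [hcn, State.average_apply, ← mul_sub, ← Finset.sum_sub_distrib,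
          Fin.sum_univ_eq_sum_range (fun k => L.convPow ω (k + 1) a - L.convPow ω k a),
          Finset.sum_range_sub (fun k => L.convPow ω k a), norm_mul]
        have e1 : ‖((n : ℂ) + 1)⁻¹‖ = 1 / ((n : ℝ) + 1) := by
          rw [norm_inv, one_div]
          congr 1
          exact_mod_cast Complex.norm_natCast (n + 1)
        rw [e1, mul_comm]
        refine mul_le_mul_of_nonneg_right ?_ (by positivity)
        refine (norm_sub_le _ _).trans ?_
        have := State.norm_apply_le (L.convPow ω (n + 1)) a
        have := State.norm_apply_le (L.convPow ω 0) a
        linarith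
      · simpa using tendsto_one_div_add_atTop_nhds_zero_nat.const_mul (2 * ‖a‖)
    exact sub_eq_zero.1 (tendsto_nhds_unique (h1.sub h2) (h3.mono_left hat))
  refine ⟨g, key (fun σ => L.conv ω σ) (L.op.continuous_conv_left ω) fun n a => ?_,
    key (fun σ => L.conv σ ω) (L.continuous_conv_left ω) fun n a => ?_⟩
  · have := L.op.prod_eq_sum Finset.univ (fun _ => ((n : ℂ) + 1)⁻¹)
      (fun k : Fin (n + 1) => L.convPow ω k) (h n) ω
      (fun a => by rw [State.average_apply, Finset.mul_sum]) (L.comul a)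
    rw [Finset.mul_sum]
    exact this
  · have := L.prod_eq_sum Finset.univ (fun _ => ((n : ℂ) + 1)⁻¹)
      (fun k : Fin (n + 1) => L.convPow ω k) (h n) ω
      (fun a => by rw [State.average_apply, Finset.mul_sum]) (L.comul a)
    rw [Finset.mul_sum]
    simp only [← convPow_conv]
    exact this

variable [Nontrivial A]

/-- The existence of the Haar state. -/
theorem exists_haar : ∃ h : State A, ∀ ω : State A, L.conv ω h = h ∧ L.conv h ω = h := by
  have hdir : Directed (· ⊇ ·) L.invariantStates := by
    intro ω₀ ω₁
    -- Invariance under an average implies invariance under its members, so the closed sets of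
    -- invariant states are directed and compactness gives a common point. Invariance on the other
    -- side is the same lemma for `L.op`.
    refine ⟨State.average 1 ![ω₀, ω₁], ?_, ?_⟩
    · rintro h ⟨hl, hr⟩
      exact ⟨L.conv_eq_of_average ![ω₀, ω₁] h hl hr 0,
        L.op.conv_eq_of_average ![ω₀, ω₁] h hr hl 0⟩
    · rintro h ⟨hl, hr⟩
      exact ⟨L.conv_eq_of_average ![ω₀, ω₁] h hl hr 1,
        L.op.conv_eq_of_average ![ω₀, ω₁] h hr hl 1⟩
  obtain ⟨h, hh⟩ := IsCompact.nonempty_iInter_of_directed_nonempty_isCompact_isClosed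
    L.invariantStates hdir L.nonempty_invariantStates
    (fun ω => (L.isClosed_invariantStates ω).isCompact) L.isClosed_invariantStates
  exact ⟨h, fun ω => Set.mem_iInter.1 hh ω⟩

end ConvolutionData

/-! ## The minimal tensor product as a tensor product of C*-algebras -/

section OpTensor

variable {H K : Type*} [NormedAddCommGroup H] [InnerProductSpace ℂ H]
  [NormedAddCommGroup K] [InnerProductSpace ℂ K]

theorem opTensor_ext {S T : HilbertTensor H K →L[ℂ] HilbertTensor H K}
    (h : ∀ x y, S (hilbertTmul x y) = T (hilbertTmul x y)) : S = T := by
  refine ContinuousLinearMap.eq_of_dense_span (span_hilbertTmul_dense H K) ?_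
  rintro _ ⟨x, y, rfl⟩
  exact h x y

theorem hilbertTmul_add_left (x x' : H) (y : K) :
    hilbertTmul (x + x') y = hilbertTmul x y + hilbertTmul x' y := by
  simp only [hilbertTmul, TensorProduct.add_tmul]
  exact UniformSpace.Completion.coe_add _ _

theorem hilbertTmul_add_right (x : H) (y y' : K) :
    hilbertTmul x (y + y') = hilbertTmul x y + hilbertTmul x y' := by
  simp only [hilbertTmul, TensorProduct.tmul_add]
  exact UniformSpace.Completion.coe_add _ _

theorem hilbertTmul_smul_left (c : ℂ) (x : H) (y : K) :
    hilbertTmul (c • x) y = c • hilbertTmul x y := by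
  simp only [hilbertTmul, ← TensorProduct.smul_tmul']
  exact UniformSpace.Completion.coe_smul (X := H ⊗[ℂ] K) c (x ⊗ₜ[ℂ] y)

theorem hilbertTmul_smul_right (c : ℂ) (x : H) (y : K) :
    hilbertTmul x (c • y) = c • hilbertTmul x y := by
  simp only [hilbertTmul, TensorProduct.tmul_smul]
  exact UniformSpace.Completion.coe_smul (X := H ⊗[ℂ] K) c (x ⊗ₜ[ℂ] y)

theorem opTensor_mul (S S' : H →L[ℂ] H) (T T' : K →L[ℂ] K) :
    opTensor (S * S') (T * T') = opTensor S T * opTensor S' T' :=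
  opTensor_ext fun x y => by simp [opTensor_hilbertTmul]

theorem opTensor_one : opTensor (1 : H →L[ℂ] H) (1 : K →L[ℂ] K) = 1 :=
  opTensor_ext fun x y => by simp [opTensor_hilbertTmul]

theorem opTensor_add_left (S S' : H →L[ℂ] H) (T : K →L[ℂ] K) :
    opTensor (S + S') T = opTensor S T + opTensor S' T :=
  opTensor_ext fun x y => by simp [opTensor_hilbertTmul, hilbertTmul_add_left]

theorem opTensor_add_right (S : H →L[ℂ] H) (T T' : K →L[ℂ] K) :
    opTensor S (T + T') = opTensor S T + opTensor S T' :=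
  opTensor_ext fun x y => by simp [opTensor_hilbertTmul, hilbertTmul_add_right]

theorem opTensor_smul_left (c : ℂ) (S : H →L[ℂ] H) (T : K →L[ℂ] K) :
    opTensor (c • S) T = c • opTensor S T :=
  opTensor_ext fun x y => by simp [opTensor_hilbertTmul, hilbertTmul_smul_left]

theorem opTensor_smul_right (c : ℂ) (S : H →L[ℂ] H) (T : K →L[ℂ] K) :
    opTensor S (c • T) = c • opTensor S T :=
  opTensor_ext fun x y => by simp [opTensor_hilbertTmul, hilbertTmul_smul_right]

theorem opTensor_star [CompleteSpace H] [CompleteSpace K] (S : H →L[ℂ] H) (T : K →L[ℂ] K) :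
    opTensor (star S) (star T) = star (opTensor S T) := by
  refine opTensor_ext fun x y => ?_
  refine (span_hilbertTmul_dense H K).eq_of_inner_left (𝕜 := ℂ) fun z hz => ?_
  rw [ContinuousLinearMap.star_eq_adjoint, ContinuousLinearMap.star_eq_adjoint,
    ContinuousLinearMap.star_eq_adjoint, ContinuousLinearMap.adjoint_inner_left]
  induction hz using Submodule.span_induction with
  | mem z hz =>
    obtain ⟨x', y', rfl⟩ := hz
    rw [opTensor_hilbertTmul, opTensor_hilbertTmul, inner_hilbertTmul, inner_hilbertTmul,
      ContinuousLinearMap.adjoint_inner_left, ContinuousLinearMap.adjoint_inner_left]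
  | zero => simp
  | add z w _ _ hz hw => rw [map_add, inner_add_right, inner_add_right, hz, hw]
  | smul c z _ hz => rw [map_smul, inner_smul_right, inner_smul_right, hz]

end OpTensor

section MinTensor

variable (A B : Type u) [CStarAlgebra A] [CStarAlgebra B]

/-- The embedding `a ↦ a ⊗ 1`. -/
def minTensorInl : A →⋆ₐ[ℂ] MinTensor A B where
  toFun a := minTmul a 1
  map_one' := minTensor_ext fun π ρ => by simp [minTensorEval_minTmul, opTensor_one]
  map_mul' a b := minTensor_ext fun π ρ => by
    rw [map_mul]; simp only [minTensorEval_minTmul, map_mul, map_one, ← opTensor_mul, mul_one]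
  map_zero' := minTensor_ext fun π ρ => by
    have := opTensor_smul_left (0 : ℂ) (0 : π.space →L[ℂ] π.space) (1 : ρ.space →L[ℂ] ρ.space)
    simp only [minTensorEval_minTmul, map_zero, map_one]
    simpa using this
  map_add' a b := minTensor_ext fun π ρ => by
    rw [map_add]; simp only [minTensorEval_minTmul, map_add, opTensor_add_left]
  commutes' c := minTensor_ext fun π ρ => by
    rw [AlgHomClass.commutes, minTensorEval_minTmul, AlgHomClass.commutes, map_one,
      Algebra.algebraMap_eq_smul_one, Algebra.algebraMap_eq_smul_one, opTensor_smul_left,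
      opTensor_one]
  map_star' a := minTensor_ext fun π ρ => by
    rw [map_star]
    simp only [minTensorEval_minTmul, ← opTensor_star, map_star, map_one, star_one]

/-- The embedding `b ↦ 1 ⊗ b`. -/
def minTensorInr : B →⋆ₐ[ℂ] MinTensor A B where
  toFun b := minTmul 1 b
  map_one' := minTensor_ext fun π ρ => by simp [minTensorEval_minTmul, opTensor_one]
  map_mul' a b := minTensor_ext fun π ρ => by
    rw [map_mul]; simp only [minTensorEval_minTmul, map_mul, map_one, ← opTensor_mul, mul_one]
  map_zero' := minTensor_ext fun π ρ => by
    have := opTensor_smul_right (0 : ℂ) (1 : π.space →L[ℂ] π.space) (0 : ρ.space →L[ℂ] ρ.space)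
    simp only [minTensorEval_minTmul, map_zero, map_one]
    simpa using this
  map_add' a b := minTensor_ext fun π ρ => by
    rw [map_add]; simp only [minTensorEval_minTmul, map_add, opTensor_add_right]
  commutes' c := minTensor_ext fun π ρ => by
    rw [AlgHomClass.commutes, minTensorEval_minTmul, AlgHomClass.commutes, map_one,
      Algebra.algebraMap_eq_smul_one, Algebra.algebraMap_eq_smul_one, opTensor_smul_right,
      opTensor_one]
  map_star' a := minTensor_ext fun π ρ => by
    rw [map_star]
    simp only [minTensorEval_minTmul, ← opTensor_star, map_star, map_one, star_one]

variable {A B}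

theorem minTmul_mul (a a' : A) (b b' : B) :
    minTmul a b * minTmul a' b' = minTmul (a * a') (b * b') :=
  minTensor_ext fun π ρ => by
    rw [map_mul]; simp only [minTensorEval_minTmul, map_mul, ← opTensor_mul]

theorem minTmul_star (a : A) (b : B) : star (minTmul a b) = minTmul (star a) (star b) :=
  minTensor_ext fun π ρ => by
    rw [map_star]; simp only [minTensorEval_minTmul, map_star, ← opTensor_star]

theorem minTensorInl_mul_minTensorInr (a : A) (b : B) :
    minTensorInl A B a * minTensorInr A B b = minTmul a b := by
  change minTmul a 1 * minTmul 1 b = _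
  rw [minTmul_mul, mul_one, one_mul]

theorem minTensorInr_mul_minTensorInl (a : A) (b : B) :
    minTensorInr A B b * minTensorInl A B a = minTmul a b := by
  change minTmul 1 b * minTmul a 1 = _
  rw [minTmul_mul, mul_one, one_mul]

/-- Elementary tensors are closed under products and adjoints and include the unit, so the *-algebra
they generate is just their linear span. -/
theorem span_minTmul_dense :
    Dense (Submodule.span ℂ {t : MinTensor A B | ∃ a b, t = minTmul a b} :
      Set (MinTensor A B)) := by
  have hind : Topology.IsInducing (fun t : MinTensor A B => (t.1 : TensorAmbient A B)) :=
    Topology.IsInducing.subtypeVal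
  rw [hind.dense_iff]
  rintro ⟨t, ht⟩
  refine closure_mono ?_ ht
  have hmem : ∀ x ∈ Submonoid.closure ({t : TensorAmbient A B | ∃ (a : A) (b : B),
      t = ambientTmul a b} ∪ star {t | ∃ (a : A) (b : B), t = ambientTmul a b}),
      ∃ (a : A) (b : B), x = (minTmul a b).1 := by
    intro x hx
    induction hx using Submonoid.closure_induction with
    | mem x hx =>
      rcases hx with ⟨a, b, rfl⟩ | ⟨a, b, h⟩
      · exact ⟨a, b, rfl⟩
      · refine ⟨star a, star b, ?_⟩
        rw [← minTmul_star, ← star_star x, h]; rfl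
    | one => exact ⟨1, 1, (congrArg Subtype.val (map_one (minTensorInl A B))).symm⟩
    | mul x y _ _ hx hy =>
      obtain ⟨a, b, rfl⟩ := hx
      obtain ⟨a', b', rfl⟩ := hy
      exact ⟨a * a', b * b', congrArg Subtype.val (minTmul_mul a a' b b')⟩
  intro x hx
  have hx' : x ∈ Submodule.span ℂ (Submonoid.closure ({t : TensorAmbient A B |
      ∃ (a : A) (b : B), t = ambientTmul a b} ∪ star {t | ∃ (a : A) (b : B), t = ambientTmul a b}) :
      Set (TensorAmbient A B)) := by
    rw [← StarAlgebra.adjoin_eq_span]; exact hx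
  have hmap : (Submodule.span ℂ {t : MinTensor A B | ∃ a b, t = minTmul a b}).map
      (minTensorSubtype A B : MinTensor A B →ₗ[ℂ] TensorAmbient A B) =
      Submodule.span ℂ ((fun t : MinTensor A B => (t.1 : TensorAmbient A B)) ''
        {t : MinTensor A B | ∃ a b, t = minTmul a b}) := Submodule.map_span _ _
  have : x ∈ (Submodule.span ℂ {t : MinTensor A B | ∃ a b, t = minTmul a b}).map
      (minTensorSubtype A B : MinTensor A B →ₗ[ℂ] TensorAmbient A B) := by
    rw [hmap]
    refine Submodule.span_mono ?_ hx'
    intro y hy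
    obtain ⟨a, b, rfl⟩ := hmem y hy
    exact ⟨_, ⟨a, b, rfl⟩, rfl⟩
  exact this

theorem inner_hilbertTmul_self {H K : Type*} [NormedAddCommGroup H] [InnerProductSpace ℂ H]
    [NormedAddCommGroup K] [InnerProductSpace ℂ K] {x : H} {y : K} (hx : inner ℂ x x = (1 : ℂ))
    (hy : inner ℂ y y = (1 : ℂ)) :
    inner ℂ (hilbertTmul x y) (hilbertTmul x y) = (1 : ℂ) := by
  rw [inner_hilbertTmul, hx, hy, one_mul]

/-- By GNS both states are vector states, and the tensor product of the two vectors gives the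
product state. -/
theorem State.exists_minTensorProd (ω : State A) (ρ : State B) :
    ∃ f : State (MinTensor A B), ∀ a b, f (minTmul a b) = ω a * ρ b := by
  obtain ⟨π, x, hx, rfl⟩ := ω.exists_eq_ofVector
  obtain ⟨σ, y, hy, rfl⟩ := ρ.exists_eq_ofVector
  refine ⟨State.ofVector (minTensorEval π σ) (hilbertTmul x y) (inner_hilbertTmul_self hx hy),
    fun a b => ?_⟩
  simp only [State.ofVector_apply, minTensorEval_minTmul, opTensor_hilbertTmul, inner_hilbertTmul]

/-- The product of two states on the minimal tensor product. -/
def State.minTensorProd (ω : State A) (ρ : State B) : State (MinTensor A B) :=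
  (State.exists_minTensorProd ω ρ).choose

theorem State.minTensorProd_minTmul (ω : State A) (ρ : State B) (a : A) (b : B) :
    ω.minTensorProd ρ (minTmul a b) = ω a * ρ b :=
  (State.exists_minTensorProd ω ρ).choose_spec a b

theorem State.minTensorProd_ofVector (π : HilbertRep A) (σ : HilbertRep B) {x : π.space}
    {y : σ.space} (hx : inner ℂ x x = 1) (hy : inner ℂ y y = 1) :
    (State.ofVector π.hom x hx).minTensorProd (State.ofVector σ.hom y hy) =
      State.ofVector (minTensorEval π σ) (hilbertTmul x y) (inner_hilbertTmul_self hx hy) := by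
  have : ((State.ofVector π.hom x hx).minTensorProd (State.ofVector σ.hom y hy)).toCLM =
      (State.ofVector (minTensorEval π σ) (hilbertTmul x y)
        (inner_hilbertTmul_self hx hy)).toCLM := by
    refine ContinuousLinearMap.eq_of_dense_span span_minTmul_dense ?_
    rintro _ ⟨a, b, rfl⟩
    simp only [State.toCLM_apply, State.minTensorProd_minTmul, State.ofVector_apply,
      minTensorEval_minTmul, opTensor_hilbertTmul, inner_hilbertTmul]
  exact State.ext fun t => DFunLike.congr_fun this t

end MinTensor

/-- The comultiplication of a compact quantum group, as a `ConvolutionData`. -/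
def CompactQuantumGroup.convolutionData {A : Type u} [CStarAlgebra A]
    (G : CompactQuantumGroup A) : ConvolutionData A (MinTensor A A) where
  inl := minTensorInl A A
  inr := minTensorInr A A
  comm a b := by rw [minTensorInl_mul_minTensorInr, minTensorInr_mul_minTensorInl]
  dense := by simpa only [minTensorInl_mul_minTensorInr] using span_minTmul_dense
  prod ω ρ := ω.minTensorProd ρ
  prod_apply ω ρ a b := by rw [minTensorInl_mul_minTensorInr, State.minTensorProd_minTmul]
  comul := G.comul
  dense_left := G.dense_left
  dense_right := G.dense_right
  coassoc ω ρ σ a := by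
    -- For vector states both sides are vector states on triple tensor products, so the claim is the
    -- diagonal case of the matrix coefficient identity `G.coassoc`.
    obtain ⟨π₁, x, hx, rfl⟩ := ω.exists_eq_ofVector
    obtain ⟨π₂, y, hy, rfl⟩ := ρ.exists_eq_ofVector
    obtain ⟨π₃, z, hz, rfl⟩ := σ.exists_eq_ofVector
    have hxy : inner ℂ (HilbertRep.convTmul G.comul x y) (HilbertRep.convTmul G.comul x y) = 1 := by
      rw [HilbertRep.inner_convTmul, hx, hy, one_mul]
    have hyz : inner ℂ (HilbertRep.convTmul G.comul y z) (HilbertRep.convTmul G.comul y z) = 1 := by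
      rw [HilbertRep.inner_convTmul, hy, hz, one_mul]
    have h₁ : (State.ofVector (minTensorEval π₁ π₂) (hilbertTmul x y)
        (inner_hilbertTmul_self hx hy)).comap G.comul =
        State.ofVector (HilbertRep.conv G.comul π₁ π₂).hom _ hxy := rfl
    have h₂ : (State.ofVector (minTensorEval π₂ π₃) (hilbertTmul y z)
        (inner_hilbertTmul_self hy hz)).comap G.comul =
        State.ofVector (HilbertRep.conv G.comul π₂ π₃).hom _ hyz := rfl
    rw [State.minTensorProd_ofVector, State.minTensorProd_ofVector, h₁, h₂,
      State.minTensorProd_ofVector, State.minTensorProd_ofVector]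
    exact G.coassoc π₁ π₂ π₃ a x x y y z z

/-! ## Invertibility of the contragredient representation -/

theorem scalarAmp_mul (A : Type*) [CStarAlgebra A] {ι κ μ : Type*} [Fintype κ]
    (S : Matrix ι κ ℂ) (T : Matrix κ μ ℂ) : scalarAmp A (S * T) = scalarAmp A S * scalarAmp A T :=
  Matrix.map_mul

theorem scalarAmp_one (A : Type*) [CStarAlgebra A] {ι : Type*} [DecidableEq ι] :
    scalarAmp A (1 : Matrix ι ι ℂ) = 1 := Matrix.map_one _ (map_zero _) (map_one _)

namespace ConvolutionData

variable {A B : Type*} [CStarAlgebra A] [CStarAlgebra B] (L : ConvolutionData A B)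

/-- A state which is invariant under the convolution with all states. -/
def IsHaar (h : State A) : Prop := ∀ ω : State A, L.conv ω h = h ∧ L.conv h ω = h

/-- The relation `Δ(u_ij) = ∑ₖ u_ik ⊗ u_kj`. -/
def IsCorep {ι : Type*} [Fintype ι] (u : Matrix ι ι A) : Prop :=
  ∀ i j, L.comul (u i j) = ∑ k, L.inl (u i k) * L.inr (u k j)

theorem IsCorep.op {L : ConvolutionData A B} {ι : Type*} [Fintype ι] {u : Matrix ι ι A}
    (hu : L.IsCorep u) : L.op.IsCorep u.conjTranspose := by
  intro i j
  change L.comul (star (u j i)) = ∑ k, L.inr (star (u k i)) * L.inl (star (u j k))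
  rw [map_star, hu, star_sum]
  exact Finset.sum_congr rfl fun k _ => by rw [star_mul, map_star, map_star]

variable {L} {h : State A} {ι : Type*} [Fintype ι] [DecidableEq ι] {u : Matrix ι ι A}

theorem sum_star_mul_of_unitary (hu : u ∈ unitary (Matrix ι ι A)) (i j : ι) :
    ∑ l, star (u l i) * u l j = if i = j then 1 else 0 := by
  have := congrArg (fun M : Matrix ι ι A => M i j) (Unitary.star_mul_self_of_mem hu)
  beta_reduce at this
  rwa [Matrix.mul_apply, Matrix.one_apply] at this

theorem sum_mul_star_of_unitary (hu : u ∈ unitary (Matrix ι ι A)) (i j : ι) :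
    ∑ l, u i l * star (u j l) = if i = j then 1 else 0 := by
  have := congrArg (fun M : Matrix ι ι A => M i j) (Unitary.mul_star_self_of_mem hu)
  beta_reduce at this
  rwa [Matrix.mul_apply, Matrix.one_apply] at this

/-- Unitarity solves the corepresentation identity for `1 ⊗ u_ji^*`. Multiplying by this element
then stays within expressions `Δ(·)(· ⊗ 1)`, on which the Haar state can be evaluated. -/
theorem inr_star_eq_sum (hΔ : L.IsCorep u) (hu : u ∈ unitary (Matrix ι ι A)) (i j : ι) :
    L.inr (star (u j i)) = ∑ l, L.comul (star (u l i)) * L.inl (u l j) := by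
  have h1 : ∀ l, L.comul (star (u l i)) * L.inl (u l j) =
      ∑ k, L.inl (star (u l k) * u l j) * L.inr (star (u k i)) := fun l => by
    rw [map_star, hΔ, star_sum, Finset.sum_mul]
    refine Finset.sum_congr rfl fun k _ => ?_
    rw [star_mul, ← map_star, ← map_star, mul_assoc, ← map_mul, ← L.comm]
  simp only [h1]
  rw [Finset.sum_comm]
  simp only [← Finset.sum_mul, ← map_sum, sum_star_mul_of_unitary hu]
  simp

variable [Nontrivial A]

theorem slice_comul_of_isHaar (hh : L.IsHaar h) (y : A) :
    L.slice h (L.comul y) = h y • (1 : A) :=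
  State.eq_of_forall fun ω => by
    rw [apply_slice, ← conv_apply, (hh ω).1, map_smul, State.apply_one, smul_eq_mul, mul_one]

/-- Replaces faithfulness of the Haar state. With `x_l = ∑ⱼ η_j u_lj`, Cauchy-Schwarz gives `h(x_l
c) = 0` for all `c`. The functional `∑ⱼ η_j (h ⊗ h)(· (1 ⊗ u_ji^*))` takes at `Δ(b)(c ⊗ 1)` the
value `∑ₗ h(b u_li^*) h(x_l c) = 0`, so by density it vanishes, also at `1 ⊗ b`. -/
theorem eq_zero_of_isHaar (hh : L.IsHaar h) (hΔ : L.IsCorep u) (hu : u ∈ unitary (Matrix ι ι A))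
    {η : ι → ℂ} (hη : ∀ l, h ((∑ j, η j • u l j) * star (∑ j, η j • u l j)) = 0) : η = 0 := by
  have hx : ∀ l c, h ((∑ j, η j • u l j) * c) = 0 := fun l c => h.apply_mul_eq_zero' (hη l) c
  have key : ∀ i b, ∑ j, η j * h (b * star (u j i)) = 0 := by
    intro i b
    have hzero : ∑ j, η j • (L.prod h h).toCLM.comp
        ((ContinuousLinearMap.mul ℂ B).flip (L.inr (star (u j i)))) = 0 := by
      refine ContinuousLinearMap.eq_of_dense_span L.dense_left ?_
      rintro _ ⟨b, c, rfl⟩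
      have e1 : ∀ j, L.prod h h (L.comul b * L.inl c * L.inr (star (u j i))) =
          ∑ l, h (b * star (u l i)) * h (u l j * c) := fun j => by
        rw [mul_assoc, L.comm, ← mul_assoc, inr_star_eq_sum hΔ hu, Finset.mul_sum, Finset.sum_mul,
          map_sum]
        refine Finset.sum_congr rfl fun l _ => ?_
        rw [← mul_assoc, mul_assoc, ← map_mul, ← map_mul, prod_mul_inl, slice_comul_of_isHaar hh,
          smul_mul_assoc, one_mul, map_smul, smul_eq_mul]
      have e2 : ∑ j, η j * ∑ l, h (b * star (u l i)) * h (u l j * c) = 0 := by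
        simp only [Finset.mul_sum]
        rw [Finset.sum_comm]
        refine Finset.sum_eq_zero fun l _ => ?_
        have := hx l c
        rw [Finset.sum_mul, map_sum] at this
        simp only [smul_mul_assoc, map_smul, smul_eq_mul] at this
        rw [← mul_zero (h (b * star (u l i))), ← this, Finset.mul_sum]
        exact Finset.sum_congr rfl fun j _ => by ring
      rw [sum_apply]
      simpa [e1] using e2
    have := DFunLike.congr_fun hzero (L.inr b)
    rw [sum_apply] at this
    simpa [← map_mul, prod_inr] using this
  -- Choosing `b = ∑ₖ η̄_k u_ki` and summing over `i`, the relations `u u^* = 1` leave exactly the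
  -- squared norm of `η`.
  have hsum : ∑ j, star (η j) * η j = 0 := by
    have h1 : ∑ i, ∑ j, η j * h ((∑ k, star (η k) • u k i) * star (u j i)) = 0 :=
      Finset.sum_eq_zero fun i _ => key i _
    rw [Finset.sum_comm] at h1
    rw [← h1]
    refine Finset.sum_congr rfl fun j _ => ?_
    rw [← Finset.mul_sum, mul_comm]
    congr 1
    rw [← map_sum]
    simp only [Finset.sum_mul]
    rw [Finset.sum_comm]
    simp only [smul_mul_assoc, ← Finset.smul_sum, sum_mul_star_of_unitary hu]
    simp
  funext j
  have := (Finset.sum_eq_zero_iff_of_nonneg fun j _ => star_mul_self_nonneg (η j)).1 hsum j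
    (Finset.mem_univ j)
  simpa using this

/-- The contragredient of a unitary corepresentation leaves a positive definite form invariant. -/
theorem exists_posDef_invariant (hΔ : L.IsCorep u) (hu : u ∈ unitary (Matrix ι ι A)) :
    ∃ F : Matrix ι ι ℂ, F.PosDef ∧
      (contragredient u).conjTranspose * scalarAmp A F * contragredient u = scalarAmp A F := by
  obtain ⟨h, hh⟩ : ∃ h, L.IsHaar h := L.exists_haar
  -- The Haar average of the standard form: without `h`, the entries are those of `(u^c)^* u^c`.
  let F : Matrix ι ι ℂ := Matrix.of fun i j => ∑ k, h (u k i * star (u k j))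
  refine ⟨F, ?_, ?_⟩
  · refine Matrix.PosDef.of_dotProduct_mulVec_pos ?_ fun x hx => ?_
    · ext i j
      simp only [F, Matrix.conjTranspose_apply, Matrix.of_apply, star_sum]
      exact Finset.sum_congr rfl fun k _ => by rw [← State.apply_star, star_mul, star_star]
    · have e : star x ⬝ᵥ F.mulVec x = ∑ k, h ((∑ j, star (x j) • u k j) *
          star (∑ j, star (x j) • u k j)) := by
        simp only [star_sum, star_smul, star_star, Finset.sum_mul, Finset.mul_sum, smul_mul_assoc,
          mul_smul_comm, map_sum, map_smul, smul_eq_mul]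
        simp only [dotProduct, Matrix.mulVec, F, Matrix.of_apply, Pi.star_apply, Finset.sum_mul,
          Finset.mul_sum]
        conv_lhs => rw [Finset.sum_comm]
        conv_rhs => rw [Finset.sum_comm]; enter [2, i]; rw [Finset.sum_comm]
        refine Finset.sum_congr rfl fun i _ => Finset.sum_congr rfl fun j _ =>
          Finset.sum_congr rfl fun k _ => ?_
        ring
      have hnn : ∀ k ∈ Finset.univ, 0 ≤ h ((∑ j, star (x j) • u k j) *
          star (∑ j, star (x j) • u k j)) := fun k _ => by
        simpa using h.nonneg (star (∑ j, star (x j) • u k j))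
      rw [e]
      refine lt_of_le_of_ne (Finset.sum_nonneg hnn) fun h0 => hx ?_
      have := eq_zero_of_isHaar hh hΔ hu (η := star x) fun l =>
        (Finset.sum_eq_zero_iff_of_nonneg hnn).1 h0.symm l (Finset.mem_univ l)
      exact star_eq_zero.1 this
  · ext i j
    refine State.eq_of_forall fun ω => ?_
    have e1 : ω (scalarAmp A F i j) = F i j := by
      rw [scalarAmp, Matrix.map_apply, Algebra.algebraMap_eq_smul_one, map_smul, State.apply_one,
        smul_eq_mul, mul_one]
    have e2 : ω (((contragredient u).conjTranspose * scalarAmp A F * contragredient u) i j) =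
        ∑ m, ∑ l, F l m * ω (u l i * star (u m j)) := by
      simp only [Matrix.mul_apply, Finset.sum_mul, map_sum, contragredient, scalarAmp,
        Matrix.map_apply, Matrix.conjTranspose_apply, star_star]
      refine Finset.sum_congr rfl fun m _ => Finset.sum_congr rfl fun l _ => ?_
      rw [Algebra.algebraMap_eq_smul_one, mul_smul_comm, mul_one, smul_mul_assoc, map_smul,
        smul_eq_mul]
    -- Invariance `h * ω = h` applied to the entries: the left leg of `Δ(u_ki u_kj^*)`, summed over
    -- `k`, integrates to `F` again, and the right leg supplies the conjugation by `u^c`.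
    have e3 : F i j = L.conv h ω (∑ k, u k i * star (u k j)) := by
      rw [(hh ω).2, map_sum]; rfl
    have e4 : ∀ k, L.comul (u k i * star (u k j)) =
        ∑ m, ∑ l, L.inl (u k l * star (u k m)) * L.inr (u l i * star (u m j)) := fun k => by
      rw [map_mul, map_star, hΔ, hΔ, star_sum, Finset.mul_sum]
      refine Finset.sum_congr rfl fun m _ => ?_
      rw [Finset.sum_mul]
      refine Finset.sum_congr rfl fun l _ => ?_
      rw [star_mul, ← map_star, ← map_star, map_mul, map_mul, ← L.comm, mul_assoc, mul_assoc,
        ← mul_assoc (L.inr _), ← L.comm, ← mul_assoc (L.inl _) (L.inl _), ← mul_assoc]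
      simp only [mul_assoc]
    rw [e1, e2, e3, conv_apply, map_sum, map_sum]
    simp only [e4, map_sum, L.prod_apply]
    conv_rhs => rw [Finset.sum_comm]; enter [2, m]; rw [Finset.sum_comm]
    refine Finset.sum_congr rfl fun m _ => Finset.sum_congr rfl fun l _ => ?_
    rw [← Finset.sum_mul]
    rfl

/-- The contragredient of a unitary corepresentation is invertible. -/
theorem isUnit_contragredient (hΔ : L.IsCorep u) (hu : u ∈ unitary (Matrix ι ι A)) :
    IsUnit (contragredient u) := by
  obtain ⟨F, hF, h1⟩ := exists_posDef_invariant hΔ hu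
  -- The form `F` gives only a left inverse, which over a noncommutative algebra is not enough. For
  -- the opposite comultiplication `u^*` is a unitary corepresentation with contragredient
  -- `(u^c)^*`; its form `E` gives the right inverse.
  obtain ⟨E, hE, h2⟩ := exists_posDef_invariant hΔ.op (Unitary.star_mem hu)
  have e1 : contragredient u.conjTranspose = (contragredient u).conjTranspose := rfl
  rw [e1, Matrix.conjTranspose_conjTranspose] at h2
  rw [isUnit_iff_exists_and_exists]
  refine ⟨⟨scalarAmp A E * (contragredient u).conjTranspose * scalarAmp A E⁻¹, ?_⟩,
    ⟨scalarAmp A F⁻¹ * ((contragredient u).conjTranspose * scalarAmp A F), ?_⟩⟩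
  · rw [← mul_assoc, ← mul_assoc, h2, ← scalarAmp_mul, Matrix.mul_nonsing_inv _
      ((Matrix.isUnit_iff_isUnit_det _).1 hE.isUnit), scalarAmp_one]
  · rw [mul_assoc, h1, ← scalarAmp_mul, Matrix.nonsing_inv_mul _
      ((Matrix.isUnit_iff_isUnit_det _).1 hF.isUnit), scalarAmp_one]

end ConvolutionData

/-! ## Intertwiners and invariant forms -/

section Intertwiners

theorem Matrix.map_star_mul {ι κ μ : Type*} [Fintype κ] (M : Matrix ι κ ℂ) (N : Matrix κ μ ℂ) :
    (M * N).map star = M.map star * N.map star := by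
  ext i j
  simp [Matrix.mul_apply]

variable {A : Type*} [CStarAlgebra A] {ι κ μ : Type*}

theorem scalarAmp_conjTranspose (T : Matrix ι κ ℂ) :
    (scalarAmp A T).conjTranspose = scalarAmp A T.conjTranspose := by
  ext i j
  simp only [scalarAmp, Matrix.conjTranspose_apply, Matrix.map_apply, algebraMap_star_comm]

theorem scalarAmp_smul (c : ℂ) (T : Matrix ι κ ℂ) :
    scalarAmp A (c • T) = c • scalarAmp A T := by
  ext i j
  simp [scalarAmp, Algebra.smul_def]

theorem scalarAmp_sub (S T : Matrix ι κ ℂ) :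
    scalarAmp A (S - T) = scalarAmp A S - scalarAmp A T := by
  ext i j
  simp [scalarAmp]

theorem contragredient_mul_scalarAmp [Fintype κ] (u : Matrix κ κ A) (T : Matrix κ ι ℂ) :
    (u * scalarAmp A T).map star = contragredient u * scalarAmp A (T.map star) := by
  ext i j
  simp only [Matrix.map_apply, Matrix.mul_apply, contragredient, scalarAmp, star_sum, star_mul,
    algebraMap_star_comm]
  refine Finset.sum_congr rfl fun k _ => ?_
  rw [← algebraMap_star_comm, Algebra.commutes]

theorem scalarAmp_mul_contragredient [Fintype κ] (u : Matrix κ κ A) (T : Matrix ι κ ℂ) :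
    (scalarAmp A T * u).map star = scalarAmp A (T.map star) * contragredient u := by
  ext i j
  simp only [Matrix.map_apply, Matrix.mul_apply, contragredient, scalarAmp, star_sum, star_mul,
    algebraMap_star_comm]
  refine Finset.sum_congr rfl fun k _ => ?_
  rw [← algebraMap_star_comm, Algebra.commutes]

theorem contragredient_contragredient (u : Matrix ι ι A) :
    contragredient (contragredient u) = u := by
  ext i j
  simp [contragredient]

theorem scalarAmp_mul_inv [Fintype ι] [DecidableEq ι] {Q : Matrix ι ι ℂ} (hQ : IsUnit Q) :
    scalarAmp A Q * scalarAmp A Q⁻¹ = 1 := by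
  rw [← scalarAmp_mul, Matrix.mul_nonsing_inv _ ((Matrix.isUnit_iff_isUnit_det _).1 hQ),
    scalarAmp_one]

theorem scalarAmp_inv_mul [Fintype ι] [DecidableEq ι] {Q : Matrix ι ι ℂ} (hQ : IsUnit Q) :
    scalarAmp A Q⁻¹ * scalarAmp A Q = 1 := by
  rw [← scalarAmp_mul, Matrix.nonsing_inv_mul _ ((Matrix.isUnit_iff_isUnit_det _).1 hQ),
    scalarAmp_one]

variable [Fintype ι] [Fintype κ] [Fintype μ] {u : Matrix ι ι A} {v : Matrix κ κ A}
  {w : Matrix μ μ A}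

theorem IsIntertwiner.contragredient {T : Matrix κ ι ℂ} (h : IsIntertwiner u v T) :
    IsIntertwiner (contragredient u) (contragredient v) (T.map star) := by
  rw [IsIntertwiner, ← contragredient_mul_scalarAmp, h, scalarAmp_mul_contragredient]

theorem IsIntertwiner.comp {S : Matrix μ κ ℂ} {T : Matrix κ ι ℂ} (hS : IsIntertwiner v w S)
    (hT : IsIntertwiner u v T) : IsIntertwiner u w (S * T) := by
  rw [IsIntertwiner, scalarAmp_mul, ← Matrix.mul_assoc, hS, Matrix.mul_assoc, hT, Matrix.mul_assoc]

theorem IsIntertwiner.sub {S T : Matrix κ ι ℂ} (hS : IsIntertwiner u v S)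
    (hT : IsIntertwiner u v T) : IsIntertwiner u v (S - T) := by
  rw [IsIntertwiner, scalarAmp_sub, Matrix.mul_sub, Matrix.sub_mul, hS, hT]

theorem IsIntertwiner.smul {T : Matrix κ ι ℂ} (hT : IsIntertwiner u v T) (c : ℂ) :
    IsIntertwiner u v (c • T) := by
  rw [IsIntertwiner, scalarAmp_smul, Matrix.mul_smul, Matrix.smul_mul, hT]

variable [DecidableEq ι] [DecidableEq κ]

theorem IsIntertwiner.conjTranspose {T : Matrix κ ι ℂ} (h : IsIntertwiner u v T)
    (hu : u ∈ unitary (Matrix ι ι A)) (hv : v ∈ unitary (Matrix κ κ A)) :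
    IsIntertwiner v u T.conjTranspose := by
  have h1 : scalarAmp A T.conjTranspose * v.conjTranspose =
      u.conjTranspose * scalarAmp A T.conjTranspose := by
    rw [← scalarAmp_conjTranspose, ← Matrix.conjTranspose_mul, h, Matrix.conjTranspose_mul]
  have hv' : v.conjTranspose * v = 1 := Unitary.star_mul_self_of_mem hv
  have hu' : u * u.conjTranspose = 1 := Unitary.mul_star_self_of_mem hu
  have h2 := congrArg (fun M => u * M * v) h1
  simp only [Matrix.mul_assoc] at h2
  rw [hv', Matrix.mul_one, ← Matrix.mul_assoc u u.conjTranspose, hu', Matrix.one_mul] at h2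
  exact h2

/-- The positive definite form `Q` is invariant under the contragredient of `u`. -/
structure IsInvariantForm (u : Matrix ι ι A) (Q : Matrix ι ι ℂ) : Prop where
  posDef : Q.PosDef
  left : (contragredient u).conjTranspose * scalarAmp A Q * contragredient u = scalarAmp A Q
  right : contragredient u * scalarAmp A Q⁻¹ * (contragredient u).conjTranspose = scalarAmp A Q⁻¹

/-- Left invariance exhibits `Q⁻¹(u^c)^*Q` as a left inverse of `u^c`; invertibility makes it
two-sided, which is right invariance. -/
theorem IsInvariantForm.of_isUnit {Q : Matrix ι ι ℂ} (hQ : Q.PosDef)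
    (h : (_root_.contragredient u).conjTranspose * scalarAmp A Q * _root_.contragredient u =
      scalarAmp A Q) (hu : IsUnit (_root_.contragredient u)) : IsInvariantForm u Q := by
  refine ⟨hQ, h, ?_⟩
  set x := _root_.contragredient u
  have h1 : scalarAmp A Q⁻¹ * (x.conjTranspose * scalarAmp A Q) * x = 1 := by
    rw [Matrix.mul_assoc, h, scalarAmp_inv_mul hQ.isUnit]
  have h2 : x * (scalarAmp A Q⁻¹ * (x.conjTranspose * scalarAmp A Q)) = 1 := by
    obtain ⟨y, hy⟩ := hu.exists_right_inv
    rwa [left_inv_eq_right_inv h1 hy]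
  calc x * scalarAmp A Q⁻¹ * x.conjTranspose
      = x * (scalarAmp A Q⁻¹ * (x.conjTranspose * scalarAmp A Q)) * scalarAmp A Q⁻¹ := by
        simp only [Matrix.mul_assoc]
        rw [scalarAmp_mul_inv hQ.isUnit, Matrix.mul_one]
    _ = scalarAmp A Q⁻¹ := by rw [h2, Matrix.one_mul]

theorem IsInvariantForm.inv_mul {Q : Matrix ι ι ℂ} (h : IsInvariantForm u Q) :
    scalarAmp A Q⁻¹ * (_root_.contragredient u).conjTranspose * scalarAmp A Q *
      _root_.contragredient u = 1 := by
  rw [Matrix.mul_assoc, Matrix.mul_assoc, ← Matrix.mul_assoc _ _ (_root_.contragredient u), h.left,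
    scalarAmp_inv_mul h.posDef.isUnit]

theorem IsInvariantForm.mul_inv {Q : Matrix ι ι ℂ} (h : IsInvariantForm u Q) :
    _root_.contragredient u * (scalarAmp A Q⁻¹ * (_root_.contragredient u).conjTranspose *
      scalarAmp A Q) = 1 := by
  rw [← Matrix.mul_assoc, ← Matrix.mul_assoc, h.right, scalarAmp_inv_mul h.posDef.isUnit]

/-- The invariant forms twist intertwiners. -/
theorem IsInvariantForm.twist {Q : Matrix ι ι ℂ} {K : Matrix κ κ ℂ} (hQ : IsInvariantForm u Q)
    (hK : IsInvariantForm v K) (hu : u ∈ unitary (Matrix ι ι A)) (hv : v ∈ unitary (Matrix κ κ A))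
    {T : Matrix κ ι ℂ} (hT : IsIntertwiner u v T) :
    IsIntertwiner u v (K.transpose * T * Q.transpose⁻¹) := by
  have h0 : _root_.contragredient v * scalarAmp A (T.map star) =
      scalarAmp A (T.map star) * _root_.contragredient u := hT.contragredient
  -- The entrywise conjugate of `T` intertwines the contragredients, hence also their inverses,
  -- which the forms express through adjoints.
  have h1 : scalarAmp A K⁻¹ * (_root_.contragredient v).conjTranspose * scalarAmp A K *
      scalarAmp A (T.map star) = scalarAmp A (T.map star) *
        (scalarAmp A Q⁻¹ * (_root_.contragredient u).conjTranspose * scalarAmp A Q) := by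
    have hX := hK.inv_mul
    have hY := hQ.mul_inv
    set X := scalarAmp A K⁻¹ * (_root_.contragredient v).conjTranspose * scalarAmp A K
    set Y := scalarAmp A Q⁻¹ * (_root_.contragredient u).conjTranspose * scalarAmp A Q
    calc X * scalarAmp A (T.map star)
        = X * (scalarAmp A (T.map star) * (_root_.contragredient u * Y)) := by
          rw [hY, Matrix.mul_one]
      _ = X * _root_.contragredient v * (scalarAmp A (T.map star) * Y) := by
          rw [← Matrix.mul_assoc (scalarAmp A (T.map star)), ← h0]
          simp only [Matrix.mul_assoc]
      _ = scalarAmp A (T.map star) * Y := by rw [hX, Matrix.one_mul]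
  have h2 : (_root_.contragredient v).conjTranspose * scalarAmp A (K * T.map star * Q⁻¹) =
      scalarAmp A (K * T.map star * Q⁻¹) * (_root_.contragredient u).conjTranspose := by
    have := congrArg (fun M => scalarAmp A K * M * scalarAmp A Q⁻¹) h1
    simp only [Matrix.mul_assoc] at this
    rw [scalarAmp_mul_inv hQ.posDef.isUnit, Matrix.mul_one, ← Matrix.mul_assoc (scalarAmp A K),
      scalarAmp_mul_inv hK.posDef.isUnit, Matrix.one_mul] at this
    simpa only [scalarAmp_mul, Matrix.mul_assoc] using this
  have h3 : IsIntertwiner (_root_.contragredient v) (_root_.contragredient u)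
      (K * T.map star * Q⁻¹).conjTranspose := by
    have := congrArg Matrix.conjTranspose h2
    rw [Matrix.conjTranspose_mul, Matrix.conjTranspose_mul, Matrix.conjTranspose_conjTranspose,
      Matrix.conjTranspose_conjTranspose, scalarAmp_conjTranspose] at this
    exact this.symm
  -- Undoing the conjugation lands in `Hom(v, u)`, and unitarity allows the adjoint back into
  -- `Hom(u, v)`. Transposes appear because `K` and `Q` are Hermitian.
  have h4 := h3.contragredient
  rw [contragredient_contragredient, contragredient_contragredient] at h4
  have h5 := h4.conjTranspose hv hu
  have h6 : (((K * T.map star * Q⁻¹).conjTranspose.map star).conjTranspose) =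
      K.transpose * T * Q.transpose⁻¹ := by
    have e1 : ∀ M : Matrix κ ι ℂ, (M.conjTranspose.map star).conjTranspose = M.map star := by
      intro M; ext i j; simp
    have hKt : K.map star = K.transpose := by
      ext i j
      exact congrArg (fun M : Matrix κ κ ℂ => M j i) hK.posDef.isHermitian
    have hQt : Q⁻¹.map star = Q.transpose⁻¹ := by
      rw [← Matrix.transpose_nonsing_inv]
      ext i j
      exact congrArg (fun M : Matrix ι ι ℂ => M j i) hQ.posDef.inv.isHermitian
    rw [e1, Matrix.map_star_mul, Matrix.map_star_mul]
    change K.map star * (T.map star).map star * Q⁻¹.map star = _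
    rw [hKt, hQt]
    congr 2
    ext i j
    simp
  rwa [h6] at h5

end Intertwiners

/-! ### Square roots of positive definite matrices -/

section PosDef

variable {ι κ : Type*} [Fintype ι] [DecidableEq ι] [Fintype κ] [DecidableEq κ]

open scoped MatrixOrder in
theorem Matrix.PosDef.exists_sqrt {Q : Matrix ι ι ℂ} (hQ : Q.PosDef) :
    ∃ R : Matrix ι ι ℂ, R.PosDef ∧ R * R = Q := by
  have h : CFC.sqrt Q * CFC.sqrt Q = Q := CFC.sqrt_mul_sqrt_self Q hQ.posSemidef.nonneg
  have hp : (CFC.sqrt Q).PosSemidef := Matrix.nonneg_iff_posSemidef.1 (CFC.sqrt_nonneg Q)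
  refine ⟨CFC.sqrt Q, hp.posDef_iff_isUnit.2 ?_, h⟩
  have := hQ.isUnit
  rw [← h] at this
  exact isUnit_of_mul_isUnit_left this

omit [DecidableEq ι] in
/-- If the squares of positive definite matrices are intertwined, then so are the matrices. -/
theorem Matrix.PosDef.mul_eq_of_sq {k : Matrix κ κ ℂ} {q : Matrix ι ι ℂ} (hk : k.PosDef)
    (hq : q.PosDef) {V : Matrix κ ι ℂ} (h : k * (k * V) = V * q * q) : k * V = V * q := by
  set Y := k * V - V * q with hY
  -- This Sylvester equation has only the zero solution: multiplying by `Y^*` and taking the trace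
  -- gives a sum of two nonnegative terms.
  have h1 : k * Y + Y * q = 0 := by
    rw [hY, Matrix.mul_sub, Matrix.sub_mul, h, Matrix.mul_assoc k]
    abel
  have h2 : (Y.conjTranspose * k * Y).trace + (Y * q * Y.conjTranspose).trace = 0 := by
    rw [Matrix.trace_mul_comm (Y * q), Matrix.mul_assoc, ← Matrix.trace_add, ← Matrix.mul_add, h1,
      Matrix.mul_zero, Matrix.trace_zero]
  have h3 : 0 ≤ (Y.conjTranspose * k * Y).trace :=
    (hk.posSemidef.conjTranspose_mul_mul_same Y).trace_nonneg
  have h4 : 0 ≤ (Y * q * Y.conjTranspose).trace :=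
    (hq.posSemidef.mul_mul_conjTranspose_same Y).trace_nonneg
  have h5 : (Y.conjTranspose * k * Y).trace = 0 := by
    refine le_antisymm ?_ h3
    rw [← h2]
    exact le_add_of_nonneg_right h4
  obtain ⟨R, hR, hRk⟩ := hk.exists_sqrt
  have h6 : ((R * Y).conjTranspose * (R * Y)).trace = 0 := by
    rw [Matrix.conjTranspose_mul, hR.isHermitian.eq, ← Matrix.mul_assoc,
      Matrix.mul_assoc Y.conjTranspose, hRk, h5]
  have h7 := Matrix.trace_conjTranspose_mul_self_eq_zero_iff.1 h6
  have h8 : Y = 0 := by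
    have := congrArg (fun M => R⁻¹ * M) h7
    beta_reduce at this
    rwa [← Matrix.mul_assoc, Matrix.nonsing_inv_mul _
      ((Matrix.isUnit_iff_isUnit_det _).1 hR.isUnit), Matrix.one_mul, Matrix.mul_zero] at this
  exact sub_eq_zero.1 h8

end PosDef

/-! ## The `Q`-matrix of an irreducible representation -/

namespace CompactQuantumGroup

variable {A : Type u} [CStarAlgebra A] {G : CompactQuantumGroup A} {ι : Type*}
  [Fintype ι] [DecidableEq ι] {u : Matrix ι ι A}

theorem IsRep.isCorep (hu : G.IsRep u) : G.convolutionData.IsCorep u := fun i j => by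
  change G.comul (u i j) = ∑ k, minTensorInl A A (u i k) * minTensorInr A A (u k j)
  simp only [minTensorInl_mul_minTensorInr, hu.comul_apply]

theorem isRep_of_map_eq (hu : IsUnit u)
    (h : u.map G.comul = u.map (minTensorInl A A) * u.map (minTensorInr A A)) : G.IsRep u :=
  ⟨hu, fun i j => by
    have := congrArg (fun M : Matrix ι ι (MinTensor A A) => M i j) h
    simpa only [Matrix.map_apply, Matrix.mul_apply, minTensorInl_mul_minTensorInr] using this⟩

theorem IsRep.map_comul (hu : G.IsRep u) :
    u.map G.comul = u.map (minTensorInl A A) * u.map (minTensorInr A A) := by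
  ext i j
  simp only [Matrix.map_apply, Matrix.mul_apply, minTensorInl_mul_minTensorInr, hu.comul_apply]

theorem scalarAmp_map {A B : Type*} [CStarAlgebra A] [CStarAlgebra B] (f : A →⋆ₐ[ℂ] B)
    {ι κ : Type*} (T : Matrix ι κ ℂ) : (scalarAmp A T).map f = scalarAmp B T := by
  ext i j
  simp only [scalarAmp, Matrix.map_apply, AlgHomClass.commutes]

theorem IsRep.conjugate (hu : G.IsRep u) {R : Matrix ι ι ℂ} (hR : IsUnit R) :
    G.IsRep (scalarAmp A R * u * scalarAmp A R⁻¹) := by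
  refine isRep_of_map_eq ?_ ?_
  · refine (IsUnit.mul ?_ hu.isUnit).mul ?_
    · exact ⟨⟨_, _, scalarAmp_mul_inv hR, scalarAmp_inv_mul hR⟩, rfl⟩
    · exact ⟨⟨_, _, scalarAmp_inv_mul hR, scalarAmp_mul_inv hR⟩, rfl⟩
  · have hmap : ∀ f : A →⋆ₐ[ℂ] MinTensor A A, (scalarAmp A R * u * scalarAmp A R⁻¹).map f =
        scalarAmp _ R * u.map f * scalarAmp _ R⁻¹ := fun f => by
      rw [Matrix.map_mul, Matrix.map_mul, scalarAmp_map, scalarAmp_map]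
    rw [hmap, hmap, hmap, hu.map_comul]
    simp only [Matrix.mul_assoc]
    rw [← Matrix.mul_assoc (scalarAmp _ R⁻¹) (scalarAmp _ R), scalarAmp_inv_mul hR, Matrix.one_mul]

/-- The two halves of unitarity of `R u^c R⁻¹`, multiplied on both sides by `R` or by `R⁻¹`, are the
two invariance relations for `Q = R²`. -/
theorem IsQMatrix.isInvariantForm {Q : Matrix ι ι ℂ} (hQ : G.IsQMatrix u Q) :
    IsInvariantForm u Q := by
  obtain ⟨hpos, ⟨R, hR, rfl, hrep⟩, -⟩ := hQ
  have hRs : (scalarAmp A R).conjTranspose = scalarAmp A R := by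
    rw [scalarAmp_conjTranspose, hR.isHermitian.eq]
  have hRi : (scalarAmp A R⁻¹).conjTranspose = scalarAmp A R⁻¹ := by
    rw [scalarAmp_conjTranspose, hR.inv.isHermitian.eq]
  have h1 : (scalarAmp A R * contragredient u * scalarAmp A R⁻¹).conjTranspose *
      (scalarAmp A R * contragredient u * scalarAmp A R⁻¹) = 1 :=
    Unitary.star_mul_self_of_mem hrep.unitary_mem
  have h2 : (scalarAmp A R * contragredient u * scalarAmp A R⁻¹) *
      (scalarAmp A R * contragredient u * scalarAmp A R⁻¹).conjTranspose = 1 :=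
    Unitary.mul_star_self_of_mem hrep.unitary_mem
  rw [Matrix.conjTranspose_mul, Matrix.conjTranspose_mul, hRs, hRi] at h1 h2
  have hc : ∀ M : Matrix ι ι A, scalarAmp A R * (scalarAmp A R⁻¹ * M) = M := fun M => by
    rw [← Matrix.mul_assoc, scalarAmp_mul_inv hR.isUnit, Matrix.one_mul]
  have hc' : ∀ M : Matrix ι ι A, scalarAmp A R⁻¹ * (scalarAmp A R * M) = M := fun M => by
    rw [← Matrix.mul_assoc, scalarAmp_inv_mul hR.isUnit, Matrix.one_mul]
  refine ⟨hpos, ?_, ?_⟩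
  · have := congrArg (fun M => scalarAmp A R * M * scalarAmp A R) h1
    simp only [Matrix.mul_assoc, scalarAmp_inv_mul hR.isUnit, Matrix.mul_one, hc] at this
    simpa only [scalarAmp_mul, Matrix.mul_assoc] using this
  · have := congrArg (fun M => scalarAmp A R⁻¹ * M * scalarAmp A R⁻¹) h2
    simp only [Matrix.mul_assoc, scalarAmp_mul_inv hR.isUnit, Matrix.mul_one, hc'] at this
    rw [Matrix.mul_inv_rev]
    simpa only [scalarAmp_mul, Matrix.mul_assoc] using this

theorem IsIrredUnitaryRep.contragredient_hom_scalar (hu : G.IsIrredUnitaryRep u)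
    {T : Matrix ι ι ℂ} (hT : IsIntertwiner (contragredient u) (contragredient u) T) :
    ∃ c : ℂ, T = c • (1 : Matrix ι ι ℂ) := by
  have h := hT.contragredient
  rw [contragredient_contragredient] at h
  obtain ⟨c, hc⟩ := hu.hom_scalar _ h
  refine ⟨star c, ?_⟩
  ext i j
  have := congrArg (fun M : Matrix ι ι ℂ => star (M i j)) hc
  simpa [Matrix.one_apply, apply_ite] using this

variable [Nontrivial A]

theorem IsUnitaryRep.isUnit_contragredient (hu : G.IsUnitaryRep u) : IsUnit (contragredient u) :=
  ConvolutionData.isUnit_contragredient hu.toIsRep.isCorep hu.unitary_mem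

theorem IsUnitaryRep.isRep_contragredient (hu : G.IsUnitaryRep u) : G.IsRep (contragredient u) :=
  ⟨hu.isUnit_contragredient, fun i j => by
    change G.comul (star (u i j)) = ∑ k, minTmul (star (u i k)) (star (u k j))
    rw [map_star, hu.comul_apply, star_sum]
    simp only [minTmul_star]⟩

/-- The Haar average `F` is invariant and stays so under scaling. Since `Hom(u^c, u^c)` is scalar,
the trace condition is a single equation, which fixes the scale. -/
theorem IsIrredUnitaryRep.exists_isQMatrix (hu : G.IsIrredUnitaryRep u) :
    ∃ Q : Matrix ι ι ℂ, G.IsQMatrix u Q := by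
  have := hu.nonempty
  obtain ⟨F, hF, hinv⟩ := ConvolutionData.exists_posDef_invariant hu.toIsRep.isCorep hu.unitary_mem
  have hF1 := hF.trace_pos
  have hF2 := hF.inv.trace_pos
  obtain ⟨a, ha, haF⟩ : ∃ a : ℝ, 0 < a ∧ (a : ℂ) = F.trace :=
    ⟨F.trace.re, (Complex.pos_iff.1 hF1).1, Complex.ext rfl (Complex.pos_iff.1 hF1).2⟩
  obtain ⟨b, hb, hbF⟩ : ∃ b : ℝ, 0 < b ∧ (b : ℂ) = F⁻¹.trace :=
    ⟨F⁻¹.trace.re, (Complex.pos_iff.1 hF2).1, Complex.ext rfl (Complex.pos_iff.1 hF2).2⟩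
  -- The positive solution of `c Tr F = c⁻¹ Tr F⁻¹`.
  set c : ℝ := √(b / a) with hc
  have hc0 : 0 < c := Real.sqrt_pos.2 (by positivity)
  have hcC : (0 : ℂ) < (c : ℂ) := by exact_mod_cast hc0
  have hc2 : (c : ℂ) * a = (c : ℂ)⁻¹ * b := by
    have h1 : c * c = b / a := Real.mul_self_sqrt (by positivity)
    have h2 : c * a = c⁻¹ * b := by field_simp at h1 ⊢; linarith
    exact_mod_cast h2
  have hQ : ((c : ℂ) • F).PosDef := hF.smul hcC
  obtain ⟨R, hR, hRQ⟩ := hQ.exists_sqrt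
  have hform : IsInvariantForm u ((c : ℂ) • F) := by
    refine .of_isUnit hQ ?_ hu.isUnit_contragredient
    rw [scalarAmp_smul, Matrix.mul_smul, Matrix.smul_mul, hinv]
  refine ⟨(c : ℂ) • F, hQ, ⟨R, hR, hRQ, ?_⟩, ?_⟩
  · have hrep := hu.isRep_contragredient.conjugate hR.isUnit
    have hRs : (scalarAmp A R).conjTranspose = scalarAmp A R := by
      rw [scalarAmp_conjTranspose, hR.isHermitian.eq]
    have hRi : (scalarAmp A R⁻¹).conjTranspose = scalarAmp A R⁻¹ := by
      rw [scalarAmp_conjTranspose, hR.inv.isHermitian.eq]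
    have h1 : star (scalarAmp A R * contragredient u * scalarAmp A R⁻¹) *
        (scalarAmp A R * contragredient u * scalarAmp A R⁻¹) = 1 := by
      rw [Matrix.star_eq_conjTranspose, Matrix.conjTranspose_mul, Matrix.conjTranspose_mul, hRs,
        hRi]
      have := hform.left
      rw [← hRQ, scalarAmp_mul] at this
      calc _ = scalarAmp A R⁻¹ * ((contragredient u).conjTranspose *
            (scalarAmp A R * scalarAmp A R) * contragredient u) * scalarAmp A R⁻¹ := by
            simp only [Matrix.mul_assoc]
        _ = 1 := by
            rw [this, ← Matrix.mul_assoc, scalarAmp_inv_mul hR.isUnit, Matrix.one_mul,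
              scalarAmp_mul_inv hR.isUnit]
    refine ⟨hrep, ?_⟩
    rw [Unitary.mem_iff]
    refine ⟨h1, ?_⟩
    obtain ⟨y, hy⟩ := hrep.isUnit.exists_right_inv
    rwa [left_inv_eq_right_inv h1 hy]
  · intro T hT
    obtain ⟨d, rfl⟩ := hu.contragredient_hom_scalar hT
    have hinv : ((c : ℂ) • F)⁻¹ = (c : ℂ)⁻¹ • F⁻¹ := by
      refine Matrix.inv_eq_right_inv ?_
      rw [Matrix.smul_mul, Matrix.mul_smul, Matrix.mul_nonsing_inv _
        ((Matrix.isUnit_iff_isUnit_det _).1 hF.isUnit), smul_smul, mul_inv_cancel₀ hcC.ne',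
        one_smul]
    rw [hinv]
    simp only [Matrix.mul_smul, Matrix.mul_one, Matrix.trace_smul, ← haF, ← hbF, smul_eq_mul, hc2]

theorem IsIrredUnitaryRep.isQMatrix (hu : G.IsIrredUnitaryRep u) : G.IsQMatrix u (G.qMatrix u) := by
  rw [qMatrix, dif_pos hu.exists_isQMatrix]
  exact hu.exists_isQMatrix.choose_spec

theorem IsIrredUnitaryRep.isInvariantForm (hu : G.IsIrredUnitaryRep u) :
    IsInvariantForm u (G.qMatrix u) :=
  hu.isQMatrix.isInvariantForm

theorem IsIrredUnitaryRep.trace_qMatrix_inv (hu : G.IsIrredUnitaryRep u) :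
    (G.qMatrix u)⁻¹.trace = (G.qMatrix u).trace := by
  have := hu.isQMatrix.2.2 1 (by rw [IsIntertwiner, scalarAmp_one, mul_one, one_mul])
  rw [mul_one, mul_one] at this
  exact this.symm

theorem IsIrredUnitaryRep.trace_qMatrix_ne_zero (hu : G.IsIrredUnitaryRep u) :
    (G.qMatrix u).trace ≠ 0 := by
  have := hu.nonempty
  exact hu.isQMatrix.1.trace_pos.ne'

end CompactQuantumGroup

/-! ## Partial traces and tensor products of representations -/

open scoped Kronecker

theorem Fintype.sum_comm_pair {α β γ δ M : Type*} [Fintype α] [Fintype β] [Fintype γ] [Fintype δ]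
    [AddCommMonoid M] (f : α → β → γ → δ → M) :
    ∑ a, ∑ b, ∑ c, ∑ d, f a b c d = ∑ c, ∑ d, ∑ a, ∑ b, f a b c d := by
  calc ∑ a, ∑ b, ∑ c, ∑ d, f a b c d = ∑ x : α × β, ∑ y : γ × δ, f x.1 x.2 y.1 y.2 := by
        simp only [Fintype.sum_prod_type]
    _ = ∑ y : γ × δ, ∑ x : α × β, f x.1 x.2 y.1 y.2 := Finset.sum_comm
    _ = _ := by simp only [Fintype.sum_prod_type]

section PartialTrace

variable {ι κ : Type*} [Fintype ι] [Fintype κ] {R : Type*} [AddCommMonoid R] [Module ℂ R]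

/-- The partial trace `id ⊗ Tr(dᵗ ·)`. -/
def rightTrace (d : Matrix κ κ ℂ) (M : Matrix (ι × κ) (ι × κ) R) : Matrix ι ι R :=
  Matrix.of fun i j => ∑ k, ∑ l, d k l • M (i, k) (j, l)

/-- The partial trace `Tr(cᵗ ·) ⊗ id`. -/
def leftTrace (c : Matrix ι ι ℂ) (M : Matrix (ι × κ) (ι × κ) R) : Matrix κ κ R :=
  Matrix.of fun k l => ∑ i, ∑ j, c i j • M (i, k) (j, l)

theorem trace_transpose_mul (c T : Matrix ι ι ℂ) :
    (c.transpose * T).trace = ∑ i, ∑ j, c i j * T i j := by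
  simp only [Matrix.trace, Matrix.diag_apply, Matrix.mul_apply, Matrix.transpose_apply]
  rw [Finset.sum_comm]

theorem trace_kronecker_transpose_mul (c : Matrix ι ι ℂ) (d : Matrix κ κ ℂ)
    (T : Matrix (ι × κ) (ι × κ) ℂ) :
    ((c ⊗ₖ d).transpose * T).trace = (c.transpose * rightTrace d T).trace := by
  simp only [trace_transpose_mul, rightTrace, Matrix.of_apply, Matrix.kroneckerMap_apply,
    Fintype.sum_prod_type, Finset.mul_sum, smul_eq_mul]
  refine Finset.sum_congr rfl fun i _ => ?_
  rw [Finset.sum_comm]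
  refine Finset.sum_congr rfl fun j _ => Finset.sum_congr rfl fun k _ =>
    Finset.sum_congr rfl fun l _ => ?_
  ring

theorem trace_kronecker_transpose_mul' (c : Matrix ι ι ℂ) (d : Matrix κ κ ℂ)
    (T : Matrix (ι × κ) (ι × κ) ℂ) :
    ((c ⊗ₖ d).transpose * T).trace = (d.transpose * leftTrace c T).trace := by
  rw [trace_kronecker_transpose_mul]
  simp only [trace_transpose_mul, rightTrace, leftTrace, Matrix.of_apply, Finset.mul_sum,
    smul_eq_mul]
  rw [Fintype.sum_comm_pair]
  refine Finset.sum_congr rfl fun k _ => Finset.sum_congr rfl fun l _ =>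
    Finset.sum_congr rfl fun i _ => Finset.sum_congr rfl fun j _ => ?_
  ring

end PartialTrace

section RepTensor

variable {A : Type*} [CStarAlgebra A] {ι κ : Type*} [Fintype ι] [Fintype κ] [DecidableEq ι]
  [DecidableEq κ] {u : Matrix ι ι A} {v : Matrix κ κ A}

theorem repTensor_mem_unitary (hu : u ∈ unitary (Matrix ι ι A))
    (hv : v ∈ unitary (Matrix κ κ A)) :
    repTensor u v ∈ unitary (Matrix (ι × κ) (ι × κ) A) := by
  rw [Unitary.mem_iff]
  constructor
  · ext ⟨i, k⟩ ⟨j, l⟩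
    have h : ∀ a b, star (u a i * v b k) * (u a j * v b l) =
        star (v b k) * (star (u a i) * u a j) * v b l := fun a b => by
      rw [star_mul]; simp only [mul_assoc]
    simp only [Matrix.mul_apply, Matrix.star_apply, repTensor, Matrix.of_apply,
      Fintype.sum_prod_type, h, Matrix.one_apply, Prod.mk.injEq]
    rw [Finset.sum_comm]
    simp only [← Finset.sum_mul, ← Finset.mul_sum,
      ConvolutionData.sum_star_mul_of_unitary hu]
    by_cases hij : i = j <;>
      simp [hij, ConvolutionData.sum_star_mul_of_unitary hv]
  · ext ⟨i, k⟩ ⟨j, l⟩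
    have h : ∀ a b, u i a * v k b * star (u j a * v l b) =
        u i a * (v k b * star (v l b)) * star (u j a) := fun a b => by
      rw [star_mul]; simp only [mul_assoc]
    simp only [Matrix.mul_apply, Matrix.star_apply, repTensor, Matrix.of_apply,
      Fintype.sum_prod_type, h, Matrix.one_apply, Prod.mk.injEq]
    simp only [← Finset.sum_mul, ← Finset.mul_sum,
      ConvolutionData.sum_mul_star_of_unitary hv]
    by_cases hkl : k = l <;>
      simp [hkl, ConvolutionData.sum_mul_star_of_unitary hu]

omit [DecidableEq ι] [DecidableEq κ] in
theorem ConvolutionData.IsCorep.repTensor {B : Type*} [CStarAlgebra B] {L : ConvolutionData A B}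
    (hu : L.IsCorep u) (hv : L.IsCorep v) : L.IsCorep (repTensor u v) := by
  intro x y
  simp only [_root_.repTensor, Matrix.of_apply, map_mul, hu _ _, hv _ _, Finset.sum_mul_sum,
    Fintype.sum_prod_type]
  refine Finset.sum_congr rfl fun a _ => Finset.sum_congr rfl fun b _ => ?_
  rw [mul_assoc, ← mul_assoc (L.inr _), ← L.comm]
  simp only [mul_assoc]

theorem IsInvariantForm.sum_left {Q : Matrix ι ι ℂ} (h : IsInvariantForm u Q) (i j : ι) :
    ∑ l, ∑ m, Q l m • (u l i * star (u m j)) = algebraMap ℂ A (Q i j) := by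
  have := congrArg (fun M : Matrix ι ι A => M i j) h.left
  simp only [Matrix.mul_apply, contragredient, scalarAmp, Matrix.map_apply,
    Matrix.conjTranspose_apply, star_star, Finset.sum_mul] at this
  rw [← this, Finset.sum_comm]
  refine Finset.sum_congr rfl fun m _ => Finset.sum_congr rfl fun l _ => ?_
  rw [← Algebra.commutes, ← Algebra.smul_def, smul_mul_assoc]

theorem IsInvariantForm.sum_right {Q : Matrix ι ι ℂ} (h : IsInvariantForm u Q) (i j : ι) :
    ∑ l, ∑ m, Q⁻¹ l m • (star (u i l) * u j m) = algebraMap ℂ A (Q⁻¹ i j) := by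
  have := congrArg (fun M : Matrix ι ι A => M i j) h.right
  simp only [Matrix.mul_apply, contragredient, scalarAmp, Matrix.map_apply,
    Matrix.conjTranspose_apply, star_star, Finset.sum_mul] at this
  rw [← this, Finset.sum_comm]
  refine Finset.sum_congr rfl fun m _ => Finset.sum_congr rfl fun l _ => ?_
  rw [← Algebra.commutes, ← Algebra.smul_def, smul_mul_assoc]

-- Conjugation produces `u_ip (v_kp' v_lq'^*) u_jq^*`, with the `v` factors adjacent. Contracting
-- them first with the invariant `d` leaves scalars, although the entries of `u` and `v` need not
-- commute.
omit [DecidableEq ι] [DecidableEq κ] in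
theorem rightTrace_conj {d : Matrix κ κ ℂ}
    (hd : ∀ p q, ∑ k, ∑ l, d k l • (v k p * star (v l q)) = algebraMap ℂ A (d p q))
    (T : Matrix (ι × κ) (ι × κ) ℂ) :
    rightTrace d (repTensor u v * scalarAmp A T * (repTensor u v).conjTranspose) =
      u * scalarAmp A (rightTrace d T) * u.conjTranspose := by
  ext i j
  have h1 : ∀ k l, (repTensor u v * scalarAmp A T * (repTensor u v).conjTranspose) (i, k) (j, l) =
      ∑ q : ι × κ, ∑ p : ι × κ, T p q • (u i p.1 * (v k p.2 * star (v l q.2)) * star (u j q.1)) := by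
    intro k l
    simp only [Matrix.mul_apply, scalarAmp, Matrix.map_apply, Matrix.conjTranspose_apply,
      Finset.sum_mul]
    refine Finset.sum_congr rfl fun q _ => Finset.sum_congr rfl fun p _ => ?_
    rw [← Algebra.commutes, ← Algebra.smul_def, smul_mul_assoc]
    simp only [repTensor, Matrix.of_apply, star_mul, mul_assoc]
  have h2 : rightTrace d (repTensor u v * scalarAmp A T * (repTensor u v).conjTranspose) i j =
      ∑ q : ι × κ, ∑ p : ι × κ, T p q • (u i p.1 * algebraMap ℂ A (d p.2 q.2) * star (u j q.1)) := by
    simp only [rightTrace, Matrix.of_apply, h1, ← hd, Finset.smul_sum, Finset.mul_sum,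
      Finset.sum_mul]
    rw [Fintype.sum_comm_pair]
    refine Finset.sum_congr rfl fun q _ => Finset.sum_congr rfl fun p _ =>
      Finset.sum_congr rfl fun k _ => Finset.sum_congr rfl fun l _ => ?_
    rw [smul_comm, mul_smul_comm, smul_mul_assoc]
  rw [h2]
  simp only [Matrix.mul_apply, scalarAmp, Matrix.map_apply, Matrix.conjTranspose_apply, rightTrace,
    Matrix.of_apply, Finset.sum_mul, Finset.mul_sum, map_sum, Fintype.sum_prod_type]
  refine Finset.sum_congr rfl fun b _ => ?_
  rw [Finset.sum_comm]
  refine Finset.sum_congr rfl fun a _ => ?_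
  rw [Finset.sum_comm]
  refine Finset.sum_congr rfl fun k _ => Finset.sum_congr rfl fun l _ => ?_
  rw [smul_eq_mul, mul_comm (d k l), map_mul, Algebra.smul_def, ← mul_assoc, ← mul_assoc,
    Algebra.commutes, ← mul_assoc, mul_assoc (u i a) _ (algebraMap ℂ A (d k l)), ← map_mul,
    mul_assoc (u i a)]

-- To bring the `u` factors together the adjoint must stand on the left. The invariance then needed
-- is for `u_pi^* u_qj`, which `Q⁻¹` satisfies and not `Q`.
omit [DecidableEq ι] [DecidableEq κ] in
theorem leftTrace_conj {c : Matrix ι ι ℂ}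
    (hc : ∀ p q, ∑ i, ∑ j, c i j • (star (u p i) * u q j) = algebraMap ℂ A (c p q))
    (T : Matrix (ι × κ) (ι × κ) ℂ) :
    leftTrace c ((repTensor u v).conjTranspose * scalarAmp A T * repTensor u v) =
      v.conjTranspose * scalarAmp A (leftTrace c T) * v := by
  ext k l
  have h1 : ∀ i j, ((repTensor u v).conjTranspose * scalarAmp A T * repTensor u v) (i, k) (j, l) =
      ∑ q : ι × κ, ∑ p : ι × κ,
        T p q • (star (v p.2 k) * (star (u p.1 i) * u q.1 j) * v q.2 l) := by
    intro i j
    simp only [Matrix.mul_apply, scalarAmp, Matrix.map_apply, Matrix.conjTranspose_apply,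
      Finset.sum_mul]
    refine Finset.sum_congr rfl fun q _ => Finset.sum_congr rfl fun p _ => ?_
    rw [← Algebra.commutes, ← Algebra.smul_def, smul_mul_assoc]
    simp only [repTensor, Matrix.of_apply, star_mul, mul_assoc]
  have h2 : leftTrace c ((repTensor u v).conjTranspose * scalarAmp A T * repTensor u v) k l =
      ∑ q : ι × κ, ∑ p : ι × κ,
        T p q • (star (v p.2 k) * algebraMap ℂ A (c p.1 q.1) * v q.2 l) := by
    simp only [leftTrace, Matrix.of_apply, h1, ← hc, Finset.smul_sum, Finset.mul_sum,
      Finset.sum_mul]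
    rw [Fintype.sum_comm_pair]
    refine Finset.sum_congr rfl fun q _ => Finset.sum_congr rfl fun p _ =>
      Finset.sum_congr rfl fun i _ => Finset.sum_congr rfl fun j _ => ?_
    rw [smul_comm, mul_smul_comm, smul_mul_assoc]
  rw [h2]
  simp only [Matrix.mul_apply, scalarAmp, Matrix.map_apply, Matrix.conjTranspose_apply, leftTrace,
    Matrix.of_apply, Finset.sum_mul, Finset.mul_sum, map_sum, Fintype.sum_prod_type]
  rw [Finset.sum_comm]
  refine Finset.sum_congr rfl fun b _ => ?_
  rw [Finset.sum_congr rfl fun j _ => Finset.sum_comm, Finset.sum_comm]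
  refine Finset.sum_congr rfl fun a _ => ?_
  rw [Finset.sum_comm]
  refine Finset.sum_congr rfl fun i _ => Finset.sum_congr rfl fun j _ => ?_
  rw [← Algebra.commutes, ← Algebra.commutes, ← Algebra.smul_def,
    ← Algebra.smul_def, smul_mul_assoc, smul_mul_assoc, smul_smul, smul_eq_mul, mul_comm (T _ _)]

/-- The inner factors `v_dk v_cl^*` contract with `R`, after which the outer ones contract with `Q`.
The other half of invariance comes from invertibility of the contragredient of the tensor product.
-/
theorem IsInvariantForm.repTensor [Nontrivial A] {B : Type*} [CStarAlgebra B]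
    {L : ConvolutionData A B} (hu : L.IsCorep u) (hv : L.IsCorep v)
    (hu' : u ∈ unitary (Matrix ι ι A)) (hv' : v ∈ unitary (Matrix κ κ A)) {Q : Matrix ι ι ℂ}
    {R : Matrix κ κ ℂ} (hQ : IsInvariantForm u Q) (hR : IsInvariantForm v R) :
    IsInvariantForm (repTensor u v) (Q ⊗ₖ R) := by
  refine .of_isUnit (hQ.posDef.kronecker hR.posDef) ?_
    (ConvolutionData.isUnit_contragredient (hu.repTensor hv) (repTensor_mem_unitary hu' hv'))
  ext ⟨i, k⟩ ⟨j, l⟩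
  have h1 : ((contragredient (_root_.repTensor u v)).conjTranspose * scalarAmp A (Q ⊗ₖ R) *
      contragredient (_root_.repTensor u v)) (i, k) (j, l) =
      ∑ a, ∑ b, Q b a • (u b i * (∑ c, ∑ d, R d c • (v d k * star (v c l))) * star (u a j)) := by
    simp only [Matrix.mul_apply, contragredient, scalarAmp, Matrix.map_apply,
      Matrix.conjTranspose_apply, star_star, Finset.sum_mul, Finset.mul_sum, Finset.smul_sum,
      Fintype.sum_prod_type, Matrix.kroneckerMap_apply]
    refine Finset.sum_congr rfl fun a _ => ?_
    rw [Finset.sum_comm]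
    refine Finset.sum_congr rfl fun b _ => Finset.sum_congr rfl fun c _ =>
      Finset.sum_congr rfl fun d _ => ?_
    rw [← Algebra.commutes, ← Algebra.smul_def, smul_mul_assoc, mul_smul]
    simp only [_root_.repTensor, Matrix.of_apply, star_mul, mul_assoc, mul_smul_comm,
      smul_mul_assoc]
  have h2 := hR.sum_left k l
  rw [Finset.sum_comm] at h2
  rw [h1, h2]
  have h3 := hQ.sum_left i j
  rw [Finset.sum_comm] at h3
  simp only [scalarAmp, Matrix.map_apply, Matrix.kroneckerMap_apply, map_mul, ← h3]
  rw [Finset.sum_mul]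
  refine Finset.sum_congr rfl fun a _ => ?_
  rw [Finset.sum_mul]
  refine Finset.sum_congr rfl fun b _ => ?_
  rw [smul_mul_assoc, ← Algebra.commutes (R k l) (u b i), mul_assoc, Algebra.commutes]

end RepTensor

/-! ## Clebsch-Gordan maps -/

namespace CompactQuantumGroup

variable {A : Type u} [CStarAlgebra A] {G : CompactQuantumGroup A}
  {α β γ : Type*} [Fintype α] [DecidableEq α] [Fintype β] [DecidableEq β]
  [Fintype γ] [DecidableEq γ] {uα : Matrix α α A} {uβ : Matrix β β A} {uγ : Matrix γ γ A}

theorem qTrace_apply (X : Matrix α α ℂ) :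
    G.qTrace uα X = ((G.qMatrix uα).transpose * X).trace := rfl

omit [Fintype α] [DecidableEq α] [Fintype β] [DecidableEq β] in
theorem partialQTrace_apply (Y : Matrix (β × γ) (β × γ) ℂ) :
    G.partialQTrace β uγ Y = rightTrace (G.qMatrix uγ) Y := by
  ext i j
  change G.qTrace uγ (Matrix.of fun k l => Y (i, k) (j, l)) = _
  rw [qTrace_apply, trace_transpose_mul]
  rfl

omit [DecidableEq α] [DecidableEq β] in
theorem cgMap_apply (V : Matrix (β × γ) α ℂ) (X : Matrix α α ℂ) :
    G.cgMap uγ V X = rightTrace (G.qMatrix uγ) (V * X * V.conjTranspose) :=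
  partialQTrace_apply _

omit [DecidableEq β] in
theorem amplify_cgMap (V : Matrix (β × γ) α ℂ) (Y : Matrix α α A) :
    amplify (G.cgMap uγ V) Y =
      rightTrace (G.qMatrix uγ) (scalarAmp A V * Y * scalarAmp A V.conjTranspose) := by
  ext p q
  have h1 : ∀ i j, G.cgMap uγ V (Matrix.single i j 1) p q =
      ∑ k, ∑ l, G.qMatrix uγ k l * (V (p, k) i * star (V (q, l) j)) := fun i j => by
    rw [cgMap_apply]
    simp only [rightTrace, Matrix.of_apply, smul_eq_mul]
    refine Finset.sum_congr rfl fun k _ => Finset.sum_congr rfl fun l _ => ?_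
    congr 1
    rw [Matrix.mul_assoc, Matrix.mul_apply]
    simp [Matrix.mul_apply, Matrix.single_apply, ite_and]
  simp only [amplify, Matrix.of_apply, h1, rightTrace, Matrix.mul_apply, scalarAmp,
    Matrix.map_apply, Finset.sum_mul, Finset.smul_sum, Finset.sum_smul, Matrix.conjTranspose_apply]
  rw [Fintype.sum_comm_pair]
  refine Finset.sum_congr rfl fun k _ => Finset.sum_congr rfl fun l _ => ?_
  rw [Finset.sum_comm]
  refine Finset.sum_congr rfl fun j _ => Finset.sum_congr rfl fun i _ => ?_
  rw [← Algebra.commutes, ← Algebra.smul_def, ← Algebra.smul_def, smul_smul, smul_smul]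
  congr 1
  ring

variable [Nontrivial A]

omit [DecidableEq β] in
/-- The Clebsch-Gordan map is covariant. -/
theorem isCovariant_cgMap (hγ : G.IsIrredUnitaryRep uγ)
    {V : Matrix (β × γ) α ℂ} (hV : IsIntertwiner uα (repTensor uβ uγ) V) :
    IsCovariant uα uβ (G.cgMap uγ V) := by
  intro X
  rw [amplify_cgMap, cgMap_apply, ← rightTrace_conj hγ.isInvariantForm.sum_left]
  congr 1
  have h1 : scalarAmp A V.conjTranspose = (scalarAmp A V).conjTranspose :=
    (scalarAmp_conjTranspose V).symm
  calc scalarAmp A V * (uα * scalarAmp A X * uα.conjTranspose) * scalarAmp A V.conjTranspose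
      = (scalarAmp A V * uα) * scalarAmp A X * (scalarAmp A V * uα).conjTranspose := by
        rw [Matrix.conjTranspose_mul, h1]
        simp only [Matrix.mul_assoc]
    _ = repTensor uβ uγ * scalarAmp A (V * X * V.conjTranspose) *
          (repTensor uβ uγ).conjTranspose := by
        rw [← hV, Matrix.conjTranspose_mul, scalarAmp_mul, scalarAmp_mul, h1]
        simp only [Matrix.mul_assoc]

omit [Nontrivial A] in
theorem isIntertwiner_of_conj_eq {u : Matrix α α A} (hu : u ∈ unitary (Matrix α α A))
    {T : Matrix α α ℂ} (h : u * scalarAmp A T * u.conjTranspose = scalarAmp A T) :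
    IsIntertwiner u u T := by
  have h1 : u.conjTranspose * u = 1 := Unitary.star_mul_self_of_mem hu
  have h2 := congrArg (fun M => M * u) h
  beta_reduce at h2
  rwa [Matrix.mul_assoc, h1, Matrix.mul_one] at h2

omit [Nontrivial A] in
theorem isIntertwiner_of_conj_eq' {u : Matrix α α A} (hu : u ∈ unitary (Matrix α α A))
    {T : Matrix α α ℂ} (h : u.conjTranspose * scalarAmp A T * u = scalarAmp A T) :
    IsIntertwiner u u T := by
  have h1 : u * u.conjTranspose = 1 := Unitary.mul_star_self_of_mem hu
  have h2 := congrArg (fun M => u * M) h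
  beta_reduce at h2
  rw [← Matrix.mul_assoc, ← Matrix.mul_assoc, h1, Matrix.one_mul] at h2
  exact h2.symm

theorem trace_transpose_mul_smul_one (c : ℂ) (Q : Matrix α α ℂ) :
    (Q.transpose * (c • (1 : Matrix α α ℂ))).trace = c * Q.trace := by
  rw [Matrix.mul_smul, Matrix.mul_one, Matrix.trace_smul, Matrix.trace_transpose, smul_eq_mul]

/-- The left and the right quantum trace coincide on the endomorphisms of a tensor product. -/
theorem trace_kronecker_eq (hβ : G.IsIrredUnitaryRep uβ) (hγ : G.IsIrredUnitaryRep uγ)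
    {T : Matrix (β × γ) (β × γ) ℂ} (hT : IsIntertwiner (repTensor uβ uγ) (repTensor uβ uγ) T) :
    ((G.qMatrix uβ ⊗ₖ G.qMatrix uγ).transpose * T).trace =
      (((G.qMatrix uβ)⁻¹ ⊗ₖ (G.qMatrix uγ)⁻¹).transpose * T).trace := by
  have hw := repTensor_mem_unitary hβ.unitary_mem hγ.unitary_mem
  have hw1 : repTensor uβ uγ * (repTensor uβ uγ).conjTranspose = 1 :=
    Unitary.mul_star_self_of_mem hw
  have hw2 : (repTensor uβ uγ).conjTranspose * repTensor uβ uγ = 1 :=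
    Unitary.star_mul_self_of_mem hw
  -- The partial trace with `Q_γ` is an endomorphism of the irreducible `uβ`, hence scalar. On
  -- scalars `Q_β` and `Q_β⁻¹` have the same trace, so the first leg may be inverted; the partial
  -- trace over the first leg with `Q_β⁻¹` then permits the same on the second.
  obtain ⟨r, hr⟩ : ∃ r : ℂ, rightTrace (G.qMatrix uγ) T = r • (1 : Matrix β β ℂ) := by
    refine hβ.hom_scalar _ (isIntertwiner_of_conj_eq hβ.unitary_mem ?_)
    rw [← rightTrace_conj hγ.isInvariantForm.sum_left, hT, Matrix.mul_assoc, hw1, Matrix.mul_one]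
    ext i j
    simp [rightTrace, scalarAmp, Algebra.smul_def]
  obtain ⟨s, hs⟩ : ∃ s : ℂ, leftTrace (G.qMatrix uβ)⁻¹ T = s • (1 : Matrix γ γ ℂ) := by
    refine hγ.hom_scalar _ (isIntertwiner_of_conj_eq' hγ.unitary_mem ?_)
    rw [← leftTrace_conj hβ.isInvariantForm.sum_right, Matrix.mul_assoc, ← hT, ← Matrix.mul_assoc,
      hw2, Matrix.one_mul]
    ext i j
    simp [leftTrace, scalarAmp, Algebra.smul_def]
  calc ((G.qMatrix uβ ⊗ₖ G.qMatrix uγ).transpose * T).trace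
      = (((G.qMatrix uβ)⁻¹ ⊗ₖ G.qMatrix uγ).transpose * T).trace := by
        rw [trace_kronecker_transpose_mul, trace_kronecker_transpose_mul, hr,
          trace_transpose_mul_smul_one, trace_transpose_mul_smul_one, hβ.trace_qMatrix_inv]
    _ = _ := by
        rw [trace_kronecker_transpose_mul', trace_kronecker_transpose_mul', hs,
          trace_transpose_mul_smul_one, trace_transpose_mul_smul_one, hγ.trace_qMatrix_inv]

/-- Intertwiners from an irreducible representation to a tensor product of irreducible
representations intertwine the `Q`-matrices. -/
theorem qMatrix_mul_intertwiner (hα : G.IsIrredUnitaryRep uα) (hβ : G.IsIrredUnitaryRep uβ)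
    (hγ : G.IsIrredUnitaryRep uγ) {V : Matrix (β × γ) α ℂ}
    (hV : IsIntertwiner uα (repTensor uβ uγ) V) :
    (G.qMatrix uβ ⊗ₖ G.qMatrix uγ).transpose * V = V * (G.qMatrix uα).transpose := by
  have hw := repTensor_mem_unitary hβ.unitary_mem hγ.unitary_mem
  have hK := IsInvariantForm.repTensor hβ.toIsRep.isCorep hγ.toIsRep.isCorep hβ.unitary_mem
    hγ.unitary_mem hβ.isInvariantForm hγ.isInvariantForm
  have hQ := hα.isInvariantForm
  have hKi : (((G.qMatrix uβ)⁻¹ ⊗ₖ (G.qMatrix uγ)⁻¹)).transpose =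
      (G.qMatrix uβ ⊗ₖ G.qMatrix uγ).transpose⁻¹ := by
    rw [← Matrix.transpose_nonsing_inv, Matrix.inv_kronecker]
  have htr : ∀ T, IsIntertwiner (repTensor uβ uγ) (repTensor uβ uγ) T →
      ((G.qMatrix uβ ⊗ₖ G.qMatrix uγ).transpose * T).trace =
        ((G.qMatrix uβ ⊗ₖ G.qMatrix uγ).transpose⁻¹ * T).trace := fun T hT => by
    rw [trace_kronecker_eq hβ hγ hT, hKi]
  have hplus := hQ.twist hK hα.unitary_mem hw hV
  -- Twisting the adjoint of `V` gives `qV^*k⁻¹`; taking adjoints again yields the intertwiner with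
  -- inverted exponents.
  have hminus := (hK.twist hQ hw hα.unitary_mem (hV.conjTranspose hα.unitary_mem hw)).conjTranspose
    hw hα.unitary_mem
  set K := G.qMatrix uβ ⊗ₖ G.qMatrix uγ with hKdef
  have hk := hK.posDef.transpose
  have hq := hQ.posDef.transpose
  have hqt : (G.qMatrix uα).transpose⁻¹.trace = (G.qMatrix uα).transpose.trace := by
    rw [← Matrix.transpose_nonsing_inv, Matrix.trace_transpose, Matrix.trace_transpose,
      hα.trace_qMatrix_inv]
  have hq0 : (G.qMatrix uα).transpose.trace ≠ 0 := by
    rw [Matrix.trace_transpose]; exact hα.trace_qMatrix_ne_zero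
  set k := K.transpose
  set q := (G.qMatrix uα).transpose
  have hqu := (Matrix.isUnit_iff_isUnit_det _).1 hq.isUnit
  have hku := (Matrix.isUnit_iff_isUnit_det _).1 hk.isUnit
  rw [Matrix.conjTranspose_mul, Matrix.conjTranspose_mul, Matrix.conjTranspose_conjTranspose,
    hk.inv.isHermitian.eq, hq.isHermitian.eq, ← Matrix.mul_assoc] at hminus
  have hD := hplus.sub hminus
  set D := k * V * q⁻¹ - k⁻¹ * V * q with hDdef
  have hDs := hD.conjTranspose hα.unitary_mem hw
  obtain ⟨s, hs⟩ := hα.hom_scalar _ (hDs.comp hplus)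
  obtain ⟨s', hs'⟩ := hα.hom_scalar _ (hDs.comp hminus)
  -- By irreducibility `D^*(kVq⁻¹)` and `D^*(k⁻¹Vq)` are scalars `s` and `s'`. Cyclicity expresses
  -- `Tr(kVD^*)` and `Tr(k⁻¹VD^*)` through them; `VD^*` is an endomorphism of the tensor product, so
  -- these traces agree, and `s = s'`.
  have e1 : (k * (V * D.conjTranspose)).trace = s * q.trace := by
    rw [← Matrix.mul_assoc, Matrix.trace_mul_comm]
    have : D.conjTranspose * (k * V) = (D.conjTranspose * (k * V * q⁻¹)) * q := by
      rw [Matrix.mul_assoc, Matrix.nonsing_inv_mul_cancel_right _ _ hqu]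
    rw [this, hs, Matrix.smul_mul, Matrix.one_mul, Matrix.trace_smul, smul_eq_mul]
  have e2 : (k⁻¹ * (V * D.conjTranspose)).trace = s' * q⁻¹.trace := by
    rw [← Matrix.mul_assoc, Matrix.trace_mul_comm]
    have : D.conjTranspose * (k⁻¹ * V) = (D.conjTranspose * (k⁻¹ * V * q)) * q⁻¹ := by
      rw [Matrix.mul_assoc, Matrix.mul_nonsing_inv_cancel_right _ _ hqu]
    rw [this, hs', Matrix.smul_mul, Matrix.one_mul, Matrix.trace_smul, smul_eq_mul]
  have e3 : s = s' := by
    have := htr _ (hV.comp hDs)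
    rw [e1, e2, hqt] at this
    exact mul_right_cancel₀ hq0 this
  -- `D^*D` is the difference of the two scalars.
  have e4 : D = 0 := by
    rw [← Matrix.conjTranspose_mul_self_eq_zero]
    nth_rewrite 2 [hDdef]
    rw [Matrix.mul_sub, hs, hs', e3, sub_self]
  have e5 : k * V * q⁻¹ = k⁻¹ * V * q := sub_eq_zero.1 e4
  refine hk.mul_eq_of_sq hq ?_
  have e6 := congrArg (fun M => k * (M * q)) e5
  beta_reduce at e6
  rw [Matrix.nonsing_inv_mul_cancel_right _ _ hqu] at e6
  rw [e6, Matrix.mul_assoc k⁻¹, Matrix.mul_assoc k⁻¹, Matrix.mul_nonsing_inv_cancel_left _ _ hku]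

/-- The two quantum traces combine to `Tr((Q_β ⊗ Q_γ)ᵗ VXV^*)`; moving the matrix through `V` and
using `V^*V = 1` finishes. -/
theorem qTrace_cgMap (hα : G.IsIrredUnitaryRep uα) (hβ : G.IsIrredUnitaryRep uβ)
    (hγ : G.IsIrredUnitaryRep uγ) {V : Matrix (β × γ) α ℂ}
    (hV : IsIsometricIntertwiner uα (repTensor uβ uγ) V) (X : Matrix α α ℂ) :
    G.qTrace uβ (G.cgMap uγ V X) = G.qTrace uα X := by
  rw [qTrace_apply, qTrace_apply, cgMap_apply, ← trace_kronecker_transpose_mul, Matrix.mul_assoc V,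
    ← Matrix.mul_assoc, qMatrix_mul_intertwiner hα hβ hγ hV.1, ← Matrix.mul_assoc,
    Matrix.trace_mul_comm, ← Matrix.mul_assoc, ← Matrix.mul_assoc, hV.2, Matrix.one_mul]

/-- Covariance at the identity makes the image an endomorphism of `uβ`, so a scalar `c`; trace
preservation reads `c d_β = d_α`. -/
theorem cgMap_one (hα : G.IsIrredUnitaryRep uα) (hβ : G.IsIrredUnitaryRep uβ)
    (hγ : G.IsIrredUnitaryRep uγ) {V : Matrix (β × γ) α ℂ}
    (hV : IsIsometricIntertwiner uα (repTensor uβ uγ) V) :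
    G.cgMap uγ V 1 = (G.qDim uα / G.qDim uβ) • (1 : Matrix β β ℂ) := by
  have hcov := isCovariant_cgMap hγ hV.1 1
  have h1 : uα * uα.conjTranspose = 1 := Unitary.mul_star_self_of_mem hα.unitary_mem
  have h2 : amplify (G.cgMap uγ V) (scalarAmp A 1) = scalarAmp A (G.cgMap uγ V 1) := by
    rw [amplify_cgMap, ← scalarAmp_mul, ← scalarAmp_mul, cgMap_apply]
    ext i j
    simp [rightTrace, scalarAmp, Algebra.smul_def]
  rw [scalarAmp_one, Matrix.mul_one, h1, ← scalarAmp_one, h2] at hcov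
  obtain ⟨c, hc⟩ := hβ.hom_scalar _ (isIntertwiner_of_conj_eq hβ.unitary_mem hcov.symm)
  have h3 := qTrace_cgMap hα hβ hγ hV 1
  rw [hc, qTrace_apply, qTrace_apply, trace_transpose_mul_smul_one, Matrix.mul_one,
    Matrix.trace_transpose] at h3
  rw [hc]
  congr 1
  change c = (G.qMatrix uα).trace / (G.qMatrix uβ).trace
  rw [eq_div_iff hβ.trace_qMatrix_ne_zero]
  exact h3

-- Restricting the equivalence to the first summand gives a nonzero intertwiner `V`. As `w` is
-- unitary, `V^*V` is an endomorphism of `uα`, hence a positive scalar, and `V` can be normalized.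
omit [Nontrivial A] in
theorem exists_isIsometricIntertwiner {κ : Type*} [Fintype κ] [DecidableEq κ] {w : Matrix κ κ A}
    (hα : G.IsIrredUnitaryRep uα) (hw : w ∈ unitary (Matrix κ κ A)) (hsub : G.IsSubrep uα w) :
    ∃ V : Matrix κ α ℂ, IsIsometricIntertwiner uα w V := by
  obtain ⟨m, w', -, T, S, hST, -, hT⟩ := hsub
  let J : Matrix (α ⊕ Fin m) α ℂ := Matrix.fromRows 1 0
  have hJ : IsIntertwiner uα (Matrix.fromBlocks uα 0 0 w') J := by
    have : scalarAmp A J = Matrix.fromRows 1 0 := by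
      ext (i | i) j
      · simp [scalarAmp, J, Matrix.one_apply, apply_ite (algebraMap ℂ A)]
      · simp [scalarAmp, J]
    rw [IsIntertwiner, this, Matrix.fromBlocks_mul_fromRows, Matrix.fromRows_mul]
    simp
  have hV := hT.comp hJ
  set V := T * J with hVdef
  obtain ⟨c, hc⟩ := hα.hom_scalar _ ((hV.conjTranspose hα.unitary_mem hw).comp hV)
  have := hα.nonempty
  obtain ⟨i⟩ := this
  have hpos : V.conjTranspose * V ≠ 0 := by
    rw [Ne, Matrix.conjTranspose_mul_self_eq_zero]
    intro h0
    have h1 : S * V = J := by rw [hVdef, ← Matrix.mul_assoc, hST, Matrix.one_mul]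
    rw [h0, Matrix.mul_zero] at h1
    have h2 := congrArg (fun M : Matrix (α ⊕ Fin m) α ℂ => M (Sum.inl i) i) h1
    simp [J] at h2
  have hc0 : c ≠ 0 := by
    rintro rfl
    exact hpos (by rw [hc, zero_smul])
  have hcn : 0 ≤ c := by
    have := (Matrix.posSemidef_conjTranspose_mul_self V).diag_nonneg (i := i)
    rw [hc] at this
    simpa using this
  obtain ⟨a, ha, rfl⟩ : ∃ a : ℝ, 0 < a ∧ c = a := by
    have hp := Complex.pos_iff.1 (lt_of_le_of_ne hcn hc0.symm)
    exact ⟨c.re, hp.1, Complex.ext rfl hp.2.symm⟩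
  refine ⟨((√a)⁻¹ : ℝ) • V, ?_, ?_⟩
  · rw [← Complex.coe_smul]
    exact hV.smul _
  · rw [Matrix.conjTranspose_smul, Matrix.smul_mul, Matrix.mul_smul, hc, smul_smul,
      ← Complex.coe_smul, smul_smul]
    have : ((star (√a)⁻¹ * (√a)⁻¹ : ℝ) : ℂ) * a = 1 := by
      have : star (√a)⁻¹ * (√a)⁻¹ * a = 1 := by
        rw [star_trivial, ← mul_inv, Real.mul_self_sqrt ha.le, inv_mul_cancel₀ ha.ne']
      exact_mod_cast this
    rw [this, one_smul]

end CompactQuantumGroup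

end

theorem mainTheorem5 {A : Type u} [CStarAlgebra A] [Nontrivial A] (G : CompactQuantumGroup A)
    {α β γ : Type*} [Fintype α] [DecidableEq α] [Fintype β] [DecidableEq β]
    [Fintype γ] [DecidableEq γ]
    (uα : Matrix α α A) (uβ : Matrix β β A) (uγ : Matrix γ γ A)
    (hα : G.IsIrredUnitaryRep uα) (hβ : G.IsIrredUnitaryRep uβ) (hγ : G.IsIrredUnitaryRep uγ)
    (hsub : G.IsSubrep uα (repTensor uβ uγ)) :
    (∃ V : Matrix (β × γ) α ℂ, IsIsometricIntertwiner uα (repTensor uβ uγ) V) ∧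
    ∀ V : Matrix (β × γ) α ℂ, IsIsometricIntertwiner uα (repTensor uβ uγ) V →
      IsCovariant uα uβ (G.cgMap uγ V) ∧
      (∀ X : Matrix α α ℂ, G.qTrace uβ (G.cgMap uγ V X) = G.qTrace uα X) ∧
      G.cgMap uγ V 1 = (G.qDim uα / G.qDim uβ) • (1 : Matrix β β ℂ) :=
  ⟨CompactQuantumGroup.exists_isIsometricIntertwiner hα
      (repTensor_mem_unitary hβ.unitary_mem hγ.unitary_mem) hsub,
    fun _ hV => ⟨CompactQuantumGroup.isCovariant_cgMap hγ hV.1,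
      fun X => CompactQuantumGroup.qTrace_cgMap hα hβ hγ hV X,
      CompactQuantumGroup.cgMap_one hα hβ hγ hV⟩⟩
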